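/- Let $a<0<b$, let $g$ be real analytic on a neighbourhood of $[a,b]$ with $g(0)=0$, $g'(0)=1$, and put $G(x)=\int_0^x g(\xi)\,d\xi$. Assume $G(a)=G(b)=c$, and $G(x)<c$ for $a<x<b$, and $x\,g(x)>0$ for $a<x<b$, $x\neq0$. The origin is called an isochronous center of $\ddot x+g(x)=0$ if, in the phase plane of $\dot x=y$, $\dot y=-g(x)$, a punctured neighbourhood of $(0,0)$ is filled with periodic orbits that all have the same minimal period. Let $x_+:[0,c]\to[0,b]$ and $x_-:[0,c]\to[a,0]$ be the inverses of the restrictions of $G$ to $[0,b]$ and $[a,0]$ (the two branches of $x=x(G)$). (i) For every $\delta\in(0,c]$ the following are equivalent: the origin is an isochronous center of $\ddot x+g(x)=0$; there is a function $f$, analytic on a neighbourhood of $[0,\delta)$, such that $x=x_+$ is an analytic solution on $0<G<\delta$ of the linear equation $$2G\,\frac{d^2x}{dG^2}+\frac{dx}{dG}=f(G);\qquad (*)$$ there is such an $f$ for $x=x_-$; there is one such $f$ for both $x_+$ and $x_-$. (ii) The functions $x=x_\pm$ satisfy $$x(0)=0,\qquad \lim_{G\to0^+}\frac{x^2}{2G}=1.\qquad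 (**)$$ (iii) Let $\delta>0$, let $f$ be any function analytic on a neighbourhood of $[0,\delta)$, and let $F(\nu)=\int_0^\nu f(t)\,dt$. Then $F(\nu)/(2\nu)^{3/2}$ is integrable on $(0,G)$ for every $G\in[0,\delta)$, and the functions on $[0,\delta)$ that are analytic solutions of $(*)$ on $(0,\delta)$ and satisfy $(**)$ are exactly the two functions $$x(G)=\sqrt{2G}\,\Bigl(\varepsilon+\int_0^G\frac{F(\nu)}{(2\nu)^{3/2}}\,d\nu\Bigr),\qquad \varepsilon\in\{1,-1\}.$$ (iv) If, for some $\delta\in(0,c]$ and some such $f$, $x_+$ is an analytic solution of $(*)$ on $(0,\delta)$, then on $[0,\delta)$ $$x_+(G)=\sqrt{2G}\,\Bigl(1+\int_0^G\frac{F(\nu)}{(2\nu)^{3/2}}\,d\nu\Bigr);$$ if $x_-$ is one, then it is given there by the same formula with $-1$ in place of $1$. -/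

import Mathlib

open Set Filter Topology

namespace ConservativeCenter

/-- The potential `G(x) = ∫₀ˣ g(ξ) dξ` of the equation `x'' + g(x) = 0`. -/
noncomputable def potential (g : ℝ → ℝ) (x : ℝ) : ℝ := ∫ ξ in (0 : ℝ)..x, g ξ

/-- The hypothesis (H): `a < 0 < b`, `G(a) = G(b) = c`, and for `a < x < b`, `x ≠ 0`, one has
`G(x) < c` and `x g(x) > 0`. -/
structure HypothesisH (g : ℝ → ℝ) (a b c : ℝ) : Prop where
  a_neg : a < 0
  b_pos : 0 < b
  potential_a : potential g a = c
  potential_b : potential g b = c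
  potential_lt : ∀ x ∈ Ioo a b, potential g x < c
  sign : ∀ x ∈ Ioo a b, x ≠ 0 → 0 < x * g x

/-- `γ = (x, y)` is a solution, defined for all times, of `x' = y`, `y' = -g(x)`. -/
def IsTrajectory (g : ℝ → ℝ) (γ : ℝ → ℝ × ℝ) : Prop :=
  ∀ t : ℝ, HasDerivAt γ ((γ t).2, -g (γ t).1) t

/-- `T` is the minimal (positive) period of `γ`. -/
def IsMinimalPeriod (γ : ℝ → ℝ × ℝ) (T : ℝ) : Prop :=
  IsLeast {τ : ℝ | 0 < τ ∧ Function.Periodic γ τ} T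

/-- The origin is an isochronous center of `x' = y`, `y' = -g(x)`: a punctured neighbourhood of the
origin in the phase plane is filled with periodic orbits, all with the same minimal period. -/
def IsIsochronousCenter (g : ℝ → ℝ) : Prop :=
  ∃ T : ℝ, ∀ᶠ p in 𝓝[≠] (0 : ℝ × ℝ),
    ∃ γ : ℝ → ℝ × ℝ, IsTrajectory g γ ∧ γ 0 = p ∧ IsMinimalPeriod γ T

/-- The branch `x = x(G)`, `0 ≤ x ≤ b`, of the inverse of the potential. -/
noncomputable def rightBranch (g : ℝ → ℝ) (b : ℝ) : ℝ → ℝ :=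
  Function.invFunOn (potential g) (Icc 0 b)

/-- The branch `x = x(G)`, `a ≤ x ≤ 0`, of the inverse of the potential. -/
noncomputable def leftBranch (g : ℝ → ℝ) (a : ℝ) : ℝ → ℝ :=
  Function.invFunOn (potential g) (Icc a 0)

/-- `x` is an analytic solution of `2 G x''(G) + x'(G) = f(G)` on `0 < G < δ`. (At the singular
point `G = 0` a solution behaves like `√(2G)`, so analyticity is asked for on the open interval.) -/
def IsAnalyticSolution (f x : ℝ → ℝ) (δ : ℝ) : Prop :=
  AnalyticOnNhd ℝ x (Ioo 0 δ) ∧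
    ∀ s ∈ Ioo 0 δ, 2 * s * deriv (deriv x) s + deriv x s = f s

/-- The conditions `x(0) = 0` and `x² / (2G) → 1` as `G → 0⁺`. -/
def InitialConditions (x : ℝ → ℝ) : Prop :=
  x 0 = 0 ∧ Tendsto (fun s : ℝ => x s ^ 2 / (2 * s)) (𝓝[>] 0) (𝓝 1)

/-- The integrand `F(ν) / (2ν)^{3/2}`, where `F(ν) = ∫₀^ν f`. -/
noncomputable def integrand (f : ℝ → ℝ) (ν : ℝ) : ℝ :=
  (∫ t in (0 : ℝ)..ν, f t) / (2 * ν) ^ (3 / 2 : ℝ)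

/-- The function `√(2G) (ε + ∫₀^G F(ν) / (2ν)^{3/2} dν)`; the sign `ε = 1` belongs to the branch
`x > 0` and `ε = -1` to the branch `x < 0`. -/
noncomputable def explicitSolution (ε : ℝ) (f : ℝ → ℝ) (s : ℝ) : ℝ :=
  √(2 * s) * (ε + ∫ ν in (0 : ℝ)..s, integrand f ν)

end ConservativeCenter

/-! Everything is read off in the energy coordinate `u = ±√(2 G(x))`, signed like `x`, in which the
orbits become the circles `u² + y² = r²`. Since `G(x) = x² k(x)` with `k` analytic and `k(0) = 1/2`,
this coordinate is analytic even at the origin; its inverse `X` is analytic with `X'(0) = 1`, `X' >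
0` and `X'(u) g(X(u)) = u` (`HypothesisH.isEnergyParam`).

With `u = r sin θ`, `y = r cos θ` the system reduces to `θ' = 1 / X'(r sin θ)`, so the period is `∫
X'(r sin s) ds` over `[0, 2π]` (`exists_trajectory`). Only `X'(u) + X'(-u)` contributes to it. Hence
the period is constant near the origin exactly when this sum is constant there, that is, when `X''`
is even near `0` (`even_of_isochronous`, `isochronous_of_even`).

On the other side, the two branches are `X(±√(2s))`, and the substitution turns `2 s x'' + x'` into
`X''(±√(2s))` (`equation_comp_sqrt`). So the linear equation says `X''(u) = f(u² / 2)` on one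
half-line, and by the identity theorem such an analytic `f` exists if and only if `X''` is even.

The explicit formula comes from the first integral `2 s x' - x = F`. The homogeneous solutions are
`C √(2s) + D`; the initial conditions remove `D` and fix the coefficient of `√(2s)` up to sign. -/

namespace ConservativeCenter

/-! ### Real analytic functions of one variable -/

lemma eventually_hasSum_coeff {f : ℝ → ℝ} {z : ℝ} (hf : AnalyticAt ℝ f z) :
    ∃ p : ℕ → ℝ, ∀ᶠ y in 𝓝 0, HasSum (fun n => y ^ n * p n) (f (z + y)) := by
  obtain ⟨p, hp⟩ := hf
  exact ⟨p.coeff, by simpa using hasFPowerSeriesAt_iff.1 hp⟩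

lemma hasFPowerSeriesAt_of_eventually_hasSum {f : ℝ → ℝ} {z : ℝ} (p : ℕ → ℝ)
    (h : ∀ᶠ y in 𝓝 0, HasSum (fun n => y ^ n * p n) (f (z + y))) :
    HasFPowerSeriesAt f (FormalMultilinearSeries.ofScalars ℝ p) z := by
  rw [hasFPowerSeriesAt_iff]
  simpa [FormalMultilinearSeries.coeff_ofScalars] using h

/-- An analytic function has a local analytic primitive. -/
lemma exists_analyticAt_primitive {f : ℝ → ℝ} {z : ℝ} (hf : AnalyticAt ℝ f z) :
    ∃ F : ℝ → ℝ, AnalyticAt ℝ F z ∧ ∀ᶠ x in 𝓝 z, HasDerivAt F (f x) x := by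
  obtain ⟨p, hp⟩ := eventually_hasSum_coeff hf
  -- Termwise integration. At `n = 0` the value is `p 0 / 0 = 0`, so this primitive vanishes at `z`.
  set q : ℕ → ℝ := fun n => p (n - 1) / n with hq
  set F : ℝ → ℝ := fun x => ∑' n, (x - z) ^ n * q n with hF
  have hFq : ∀ᶠ y in 𝓝 (0 : ℝ), HasSum (fun n => y ^ n * q n) (F (z + y)) := by
    filter_upwards [hp] with y hy
    have hs : Summable (fun n => y ^ n * q n) := by
      rw [← summable_nat_add_iff 1]
      refine Summable.of_norm_bounded (g := fun n => |y| * |y ^ n * p n|)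
        (hy.summable.abs.mul_left _) fun n => ?_
      have h1 : |((n : ℝ) + 1)⁻¹| ≤ 1 := by
        rw [abs_of_pos (by positivity)]
        exact inv_le_one_of_one_le₀ (by linarith [n.cast_nonneg (α := ℝ)])
      simp only [hq, Real.norm_eq_abs, Nat.add_sub_cancel, Nat.cast_add, Nat.cast_one]
      have : y ^ (n + 1) * (p n / (n + 1)) = y * (y ^ n * p n) * ((n : ℝ) + 1)⁻¹ := by ring
      rw [this, abs_mul, abs_mul y]
      exact mul_le_of_le_one_right (by positivity) h1
    simpa [hF] using hs.hasSum
  have hFs := hasFPowerSeriesAt_of_eventually_hasSum q hFq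
  refine ⟨F, hFs.analyticAt, ?_⟩
  obtain ⟨r, hr⟩ := hFs
  have hd := hr.fderiv
  have hball : ∀ᶠ y in 𝓝 (0 : ℝ), y ∈ Metric.eball (0 : ℝ) r := Metric.eball_mem_nhds _ hr.r_pos
  have key : ∀ᶠ y in 𝓝 (0 : ℝ), HasDerivAt F (f (z + y)) (z + y) := by
    filter_upwards [hp, hball] with y hy hyb
    have h1 := (hd.hasSum hyb).mapL (ContinuousLinearMap.apply ℝ ℝ (1 : ℝ))
    have hda : DifferentiableAt ℝ F (z + y) := by
      refine (hr.analyticAt_of_mem ?_).differentiableAt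
      simpa [Metric.mem_eball, edist_eq_enorm_sub] using hyb
    have h2 : HasSum (fun n => y ^ n * p n) (deriv F (z + y)) := by
      have h3 : ∀ n, y ^ n * p n = ContinuousLinearMap.apply ℝ ℝ (1 : ℝ)
          ((FormalMultilinearSeries.ofScalars ℝ q).derivSeries n fun _ => y) := fun n => by
        have := FormalMultilinearSeries.derivSeries_coeff_one
          (FormalMultilinearSeries.ofScalars ℝ q) n
        rw [FormalMultilinearSeries.coeff_ofScalars] at this
        rw [FormalMultilinearSeries.apply_eq_pow_smul_coeff, map_smul]
        simp only [ContinuousLinearMap.apply_apply, this]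
        simp only [hq, nsmul_eq_mul, smul_eq_mul, Nat.add_sub_cancel]
        push_cast
        field_simp
      simp only [h3]
      exact h1
    rw [hy.unique h2]
    exact hda.hasDerivAt
  rw [← map_add_left_nhds_zero, eventually_map]
  exact key

/-- A primitive of an analytic function is analytic. -/
lemma analyticAt_of_eventually_hasDerivAt {f F : ℝ → ℝ} {z : ℝ} (hf : AnalyticAt ℝ f z)
    (hF : ∀ᶠ x in 𝓝 z, HasDerivAt F (f x) x) : AnalyticAt ℝ F z := by
  obtain ⟨H, hH, hHd⟩ := exists_analyticAt_primitive hf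
  obtain ⟨ε, hε, hb⟩ := Metric.eventually_nhds_iff_ball.1 (hF.and hHd)
  have hconst : ∀ x ∈ Metric.ball z ε, F x - H x = F z - H z := fun x hx =>
    (convex_ball z ε).is_const_of_fderivWithin_eq_zero (𝕜 := ℝ) (f := fun x => F x - H x)
      (fun y hy => ((hb y hy).1.sub (hb y hy).2).differentiableAt.differentiableWithinAt)
      (fun y hy => by
        rw [fderivWithin_of_isOpen Metric.isOpen_ball hy]
        have := ((hb y hy).1.sub (hb y hy).2).hasFDerivAt.fderiv
        rw [show (fun x => F x - H x) = F - H from rfl]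
        simpa using this) hx (Metric.mem_ball_self hε)
  refine (hH.add (analyticAt_const (v := F z - H z))).congr ?_
  filter_upwards [Metric.ball_mem_nhds z hε] with x hx
  simp only [Pi.add_apply]
  linarith [hconst x hx]

/-- An even analytic function is an analytic function of `u² / 2`. -/
lemma exists_analyticAt_of_even {E : ℝ → ℝ} (hE : AnalyticAt ℝ E 0)
    (heven : ∀ᶠ u in 𝓝 0, E (-u) = E u) :
    ∃ f : ℝ → ℝ, AnalyticAt ℝ f 0 ∧ ∀ᶠ u in 𝓝 0, E u = f (u ^ 2 / 2) := by
  obtain ⟨p, hp⟩ := eventually_hasSum_coeff hE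
  simp only [zero_add] at hp
  have hneg : Tendsto (fun u : ℝ => -u) (𝓝 0) (𝓝 0) := by
    simpa using (continuous_neg (G := ℝ)).tendsto 0
  have hsum : ∀ᶠ u in 𝓝 (0 : ℝ), HasSum (fun k => (u ^ 2 / 2) ^ k * (2 ^ k * p (2 * k))) (E u) := by
    filter_upwards [hp, hneg.eventually hp, heven] with u h1 h2 h3
    rw [h3] at h2
    -- Averaging the expansions at `u` and `-u` cancels the odd terms.
    have h4 : HasSum (fun n => (u ^ n * p n + (-u) ^ n * p n) / 2) (E u) := by
      simpa using (h1.add h2).div_const 2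
    have hinj : Function.Injective (fun k : ℕ => 2 * k) := fun a b h => by simpa using h
    rw [← hinj.hasSum_iff] at h4
    · convert h4 using 2 with k
      simp only [Function.comp]
      rw [(even_two_mul k).neg_pow, pow_mul]
      ring_nf
      rw [mul_assoc, ← mul_pow]
      norm_num
    · intro n hn
      have hodd : Odd n := by
        rw [← Nat.not_even_iff_odd]
        rintro ⟨k, rfl⟩
        exact hn ⟨k, by simp; ring⟩
      rw [hodd.neg_pow]
      ring
  set f : ℝ → ℝ := fun s => ∑' k, s ^ k * (2 ^ k * p (2 * k)) with hf
  refine ⟨f, (hasFPowerSeriesAt_of_eventually_hasSum (fun k => 2 ^ k * p (2 * k)) ?_).analyticAt, ?_⟩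
  -- The terms at `s` have the same absolute values as those at `u = √(2|s|)`, which gives
  -- summability for negative `s` too.
  · have ht : Tendsto (fun s : ℝ => √(2 * |s|)) (𝓝 0) (𝓝 0) := by
      have : Continuous (fun s : ℝ => √(2 * |s|)) := by fun_prop
      simpa using this.tendsto 0
    filter_upwards [ht.eventually hsum] with s hs
    simp only [hf, zero_add]
    refine Summable.hasSum (Summable.of_norm ?_)
    refine hs.summable.norm.congr fun k => ?_
    rw [Real.sq_sqrt (by positivity)]
    simp
  · filter_upwards [hsum] with u hu
    exact hu.tsum_eq.symm

lemma analyticAt_sqrt {x : ℝ} (hx : x ≠ 0) : AnalyticAt ℝ (fun y => √y) x :=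
  -- Here `⊤` is the exponent `ω`, so this is analyticity and not just smoothness.
  (Real.contDiffAt_sqrt (n := ⊤) hx).analyticAt

/-! ### The linear equation `2 s x'' + x' = f` -/

lemma exists_eq_const_of_hasDerivAt_zero {δ : ℝ} {h : ℝ → ℝ}
    (hh : ∀ s ∈ Ioo 0 δ, HasDerivAt h 0 s) : ∃ C, ∀ s ∈ Ioo 0 δ, h s = C := by
  rcases (Ioo (0 : ℝ) δ).eq_empty_or_nonempty with he | ⟨t, ht⟩
  · exact ⟨0, by simp [he]⟩
  · refine ⟨h t, fun s hs => (convex_Ioo 0 δ).is_const_of_fderivWithin_eq_zero (𝕜 := ℝ)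
      (fun y hy => (hh y hy).differentiableAt.differentiableWithinAt)
      (fun y hy => ?_) hs ht⟩
    rw [fderivWithin_of_isOpen isOpen_Ioo hy, (hh y hy).hasFDerivAt.fderiv]
    simp

lemma hasDerivAt_sqrt_two_mul {s : ℝ} (hs : 0 < s) :
    HasDerivAt (fun s => √(2 * s)) (1 / √(2 * s)) s := by
  have h := ((hasDerivAt_id s).const_mul 2).sqrt (by simpa using hs.ne')
  simp only [id] at h
  convert h using 1
  field_simp

lemma analyticAt_sqrt_two_mul {s : ℝ} (hs : 0 < s) : AnalyticAt ℝ (fun s => √(2 * s)) s :=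
  (analyticAt_sqrt (x := 2 * s) (by positivity)).comp
    (f := fun s : ℝ => 2 * s) (analyticAt_const.mul analyticAt_id)

lemma rpow_three_halves {y : ℝ} (hy : 0 ≤ y) : y ^ (3 / 2 : ℝ) = y * √y := by
  rcases hy.eq_or_lt with rfl | hy
  · simp
  · rw [show (3 / 2 : ℝ) = 1 + 1 / 2 by norm_num, Real.rpow_add hy, Real.rpow_one,
      Real.sqrt_eq_rpow]

section

variable {f : ℝ → ℝ} {δ : ℝ}

lemma intervalIntegrable_of_analyticOnNhd_Ico (hf : AnalyticOnNhd ℝ f (Ico 0 δ)) {s : ℝ}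
    (hs : s ∈ Ico 0 δ) : IntervalIntegrable f MeasureTheory.volume 0 s := by
  refine ContinuousOn.intervalIntegrable fun x hx => ?_
  rw [uIcc_of_le hs.1] at hx
  exact (hf x ⟨hx.1, hx.2.trans_lt hs.2⟩).continuousAt.continuousWithinAt

lemma hasDerivAt_integral_of_analyticOnNhd_Ico (hf : AnalyticOnNhd ℝ f (Ico 0 δ)) {s : ℝ}
    (hs : s ∈ Ioo 0 δ) : HasDerivAt (fun ν => ∫ t in (0 : ℝ)..ν, f t) (f s) s := by
  refine intervalIntegral.integral_hasDerivAt_right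
    (intervalIntegrable_of_analyticOnNhd_Ico hf ⟨hs.1.le, hs.2⟩)
    (ContinuousOn.stronglyMeasurableAtFilter isOpen_Ioo (fun x hx => ?_) s hs)
    (hf s ⟨hs.1.le, hs.2⟩).continuousAt
  exact (hf x ⟨hx.1.le, hx.2⟩).continuousAt.continuousWithinAt

lemma analyticAt_integral (hf : AnalyticOnNhd ℝ f (Ico 0 δ)) {s : ℝ}
    (hs : s ∈ Ioo 0 δ) : AnalyticAt ℝ (fun ν => ∫ t in (0 : ℝ)..ν, f t) s := by
  refine analyticAt_of_eventually_hasDerivAt (hf s ⟨hs.1.le, hs.2⟩) ?_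
  filter_upwards [isOpen_Ioo.mem_nhds hs] with x hx
  exact hasDerivAt_integral_of_analyticOnNhd_Ico hf hx

lemma integrand_eq {ν : ℝ} (hν : 0 ≤ ν) :
    integrand f ν = (∫ t in (0 : ℝ)..ν, f t) / (2 * ν * √(2 * ν)) := by
  rw [integrand, rpow_three_halves (by positivity)]

lemma analyticAt_integrand (hf : AnalyticOnNhd ℝ f (Ico 0 δ)) {s : ℝ}
    (hs : s ∈ Ioo 0 δ) : AnalyticAt ℝ (integrand f) s := by
  have h0 : 0 < s := hs.1
  have h2 : AnalyticAt ℝ (fun ν : ℝ => 2 * ν) s := analyticAt_const.mul analyticAt_id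
  refine AnalyticAt.congr ((analyticAt_integral hf hs).fun_div
    (h2.fun_mul (analyticAt_sqrt_two_mul hs.1)) (by positivity)) ?_
  filter_upwards [isOpen_Ioo.mem_nhds hs] with x hx
  rw [integrand_eq hx.1.le]

/-- A bound `M` for `f` gives `|F(ν)| ≤ M ν`, so the integrand is `O(ν^(-1/2))`. -/
lemma intervalIntegrable_integrand (hf : AnalyticOnNhd ℝ f (Ico 0 δ)) {s : ℝ}
    (hs : s ∈ Ico 0 δ) : IntervalIntegrable (integrand f) MeasureTheory.volume 0 s := by
  obtain ⟨M, hM⟩ := isCompact_Icc.exists_bound_of_continuousOn (s := Icc 0 s) (f := f)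
    fun x hx => (hf x ⟨hx.1, hx.2.trans_lt hs.2⟩).continuousAt.continuousWithinAt
  have hM0 : 0 ≤ M := (norm_nonneg _).trans (hM 0 ⟨le_rfl, hs.1⟩)
  have hpow : IntervalIntegrable (fun ν : ℝ => M * ν ^ (-1 / 2 : ℝ)) MeasureTheory.volume 0 s :=
    (intervalIntegral.intervalIntegrable_rpow' (by norm_num)).const_mul M
  refine hpow.mono_fun ?_ ?_
  · rw [uIoc_of_le hs.1]
    refine ContinuousOn.aestronglyMeasurable (fun x hx => ?_) measurableSet_Ioc
    exact (analyticAt_integrand hf ⟨hx.1, hx.2.trans_lt hs.2⟩).continuousAt.continuousWithinAt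
  · refine (MeasureTheory.ae_restrict_iff' measurableSet_uIoc).2 (MeasureTheory.ae_of_all _ fun ν hν => ?_)
    rw [uIoc_of_le hs.1] at hν
    have hν0 : 0 < ν := hν.1
    have hF : ‖∫ t in (0 : ℝ)..ν, f t‖ ≤ M * |ν - 0| :=
      intervalIntegral.norm_integral_le_of_norm_le_const fun x hx => by
        rw [uIoc_of_le hν0.le] at hx
        exact hM x ⟨hx.1.le, hx.2.trans hν.2⟩
    rw [sub_zero, abs_of_pos hν0] at hF
    beta_reduce
    rw [integrand_eq hν0.le, norm_div, norm_mul M, Real.norm_of_nonneg hM0,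
      Real.norm_of_nonneg (by positivity : 0 ≤ 2 * ν * √(2 * ν)),
      Real.norm_of_nonneg (by positivity : 0 ≤ ν ^ (-1 / 2 : ℝ)), div_le_iff₀ (by positivity)]
    have h1 : ν ^ (-1 / 2 : ℝ) * √ν = 1 := by
      rw [Real.sqrt_eq_rpow, ← Real.rpow_add hν0]
      norm_num
    have h2 : √ν ≤ √(2 * ν) := Real.sqrt_le_sqrt (by linarith)
    calc ‖∫ t in (0 : ℝ)..ν, f t‖ ≤ M * ν * (ν ^ (-1 / 2 : ℝ) * √ν) := by rw [h1, mul_one]; exact hF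
      _ ≤ M * ν * (ν ^ (-1 / 2 : ℝ) * √(2 * ν)) := by gcongr
      _ ≤ 2 * (M * ν * (ν ^ (-1 / 2 : ℝ) * √(2 * ν))) := by
        have : 0 ≤ M * ν * (ν ^ (-1 / 2 : ℝ) * √(2 * ν)) := by positivity
        linarith
      _ = M * ν ^ (-1 / 2 : ℝ) * (2 * ν * √(2 * ν)) := by ring

lemma hasDerivAt_integral_integrand (hf : AnalyticOnNhd ℝ f (Ico 0 δ)) {s : ℝ}
    (hs : s ∈ Ioo 0 δ) :
    HasDerivAt (fun ν => ∫ t in (0 : ℝ)..ν, integrand f t) (integrand f s) s := by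
  refine intervalIntegral.integral_hasDerivAt_right
    (intervalIntegrable_integrand hf ⟨hs.1.le, hs.2⟩)
    (ContinuousOn.stronglyMeasurableAtFilter isOpen_Ioo (fun x hx => ?_) s hs)
    (analyticAt_integrand hf hs).continuousAt
  exact (analyticAt_integrand hf hx).continuousAt.continuousWithinAt

lemma tendsto_integral_integrand (hδ : 0 < δ) (hf : AnalyticOnNhd ℝ f (Ico 0 δ)) :
    Tendsto (fun s => ∫ t in (0 : ℝ)..s, integrand f t) (𝓝[>] 0) (𝓝 0) := by
  have hs : δ / 2 ∈ Ico 0 δ := ⟨by positivity, by linarith⟩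
  have h := intervalIntegral.continuousOn_primitive_interval' (intervalIntegrable_integrand hf hs)
    left_mem_uIcc
  rw [uIcc_of_le hs.1] at h
  have h0 := h 0 ⟨le_rfl, hs.1⟩
  rw [ContinuousWithinAt, intervalIntegral.integral_same] at h0
  refine h0.mono_left ?_
  rw [← nhdsWithin_Ioo_eq_nhdsGT (show (0 : ℝ) < δ / 2 by positivity)]
  exact nhdsWithin_mono _ Ioo_subset_Icc_self

/-- The derivative is put in the form `2 s x' - x = F`, which yields `2 s x'' + x' = f` on
differentiating once more. -/
lemma hasDerivAt_explicitSolution (ε : ℝ) (hf : AnalyticOnNhd ℝ f (Ico 0 δ)) {s : ℝ}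
    (hs : s ∈ Ioo 0 δ) :
    HasDerivAt (explicitSolution ε f)
      ((explicitSolution ε f s + ∫ t in (0 : ℝ)..s, f t) / (2 * s)) s := by
  have hs0 : 0 < s := hs.1
  have h := (hasDerivAt_sqrt_two_mul hs0).mul
    ((hasDerivAt_integral_integrand hf hs).const_add ε)
  refine h.congr_deriv ?_
  rw [integrand_eq hs0.le, explicitSolution]
  have hsq : √(2 * s) ^ 2 = 2 * s := Real.sq_sqrt (by positivity)
  have hne : √(2 * s) ≠ 0 := by positivity
  rw [← hsq]
  rw [Real.sqrt_sq (by positivity)]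
  field_simp

lemma isAnalyticSolution_explicitSolution (ε : ℝ) (hf : AnalyticOnNhd ℝ f (Ico 0 δ)) :
    IsAnalyticSolution f (explicitSolution ε f) δ := by
  refine ⟨fun s hs => ?_, fun s hs => ?_⟩
  · refine (analyticAt_sqrt_two_mul hs.1).fun_mul (analyticAt_const.fun_add ?_)
    refine analyticAt_of_eventually_hasDerivAt (analyticAt_integrand hf hs) ?_
    filter_upwards [isOpen_Ioo.mem_nhds hs] with x hx
    exact hasDerivAt_integral_integrand hf hx
  · have hs0 : 0 < s := hs.1
    have hd : deriv (explicitSolution ε f) =ᶠ[𝓝 s]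
        fun s => (explicitSolution ε f s + ∫ t in (0 : ℝ)..s, f t) / (2 * s) := by
      filter_upwards [isOpen_Ioo.mem_nhds hs] with x hx
      exact (hasDerivAt_explicitSolution ε hf hx).deriv
    have h2 := ((hasDerivAt_explicitSolution ε hf hs).add
      (hasDerivAt_integral_of_analyticOnNhd_Ico hf hs)).fun_div
      ((hasDerivAt_id s).const_mul 2) (by simpa using hs0.ne')
    have h3 := (h2.congr_of_eventuallyEq hd).deriv
    rw [h3, hd.self_of_nhds]
    simp only [id, Pi.add_apply]
    field_simp
    ring

lemma tendsto_explicitSolution_div (ε : ℝ) (hδ : 0 < δ) (hf : AnalyticOnNhd ℝ f (Ico 0 δ)) :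
    Tendsto (fun s => explicitSolution ε f s / √(2 * s)) (𝓝[>] 0) (𝓝 ε) := by
  have h := (tendsto_integral_integrand hδ hf).const_add ε
  rw [add_zero] at h
  refine h.congr' ?_
  filter_upwards [self_mem_nhdsWithin] with s hs
  have : 0 < √(2 * s) := Real.sqrt_pos.2 (by simpa using hs)
  rw [explicitSolution]
  field_simp

/-- Two solutions of the equation differ by a solution `C √(2s) + D` of the homogeneous one. -/
lemma IsAnalyticSolution.exists_sub_eq {x y : ℝ → ℝ} (hx : IsAnalyticSolution f x δ)
    (hy : IsAnalyticSolution f y δ) :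
    ∃ C D : ℝ, ∀ s ∈ Ioo 0 δ, x s - y s = C * √(2 * s) + D := by
  -- `√(2s)` is an integrating factor: `(√(2s) w')' = (2 s w'' + w') / √(2s)`.
  obtain ⟨C, hC⟩ := exists_eq_const_of_hasDerivAt_zero (δ := δ)
    (h := fun s => √(2 * s) * (deriv x s - deriv y s)) fun s hs => by
      have hs0 : 0 < s := hs.1
      refine ((hasDerivAt_sqrt_two_mul hs.1).mul
        ((hx.1 s hs).deriv.differentiableAt.hasDerivAt.sub
          (hy.1 s hs).deriv.differentiableAt.hasDerivAt)).congr_deriv ?_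
      have h1 := hx.2 s hs
      have h2 := hy.2 s hs
      have hne : √(2 * s) ≠ 0 := by positivity
      have hsq : √(2 * s) * √(2 * s) = 2 * s := Real.mul_self_sqrt (by positivity)
      field_simp
      simp only [Pi.sub_apply]
      rw [show √(2 * s) ^ 2 = 2 * s by rw [sq]; exact hsq]
      linear_combination h1 - h2
  obtain ⟨D, hD⟩ := exists_eq_const_of_hasDerivAt_zero (δ := δ)
    (h := fun s => x s - y s - C * √(2 * s)) fun s hs => by
      have hs0 : 0 < s := hs.1
      refine (((hx.1 s hs).differentiableAt.hasDerivAt.sub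
        (hy.1 s hs).differentiableAt.hasDerivAt).sub
          ((hasDerivAt_sqrt_two_mul hs.1).const_mul C)).congr_deriv ?_
      have hne : √(2 * s) ≠ 0 := by positivity
      rw [← hC s hs]
      field_simp
      ring
  exact ⟨C, D, fun s hs => by linarith [hD s hs]⟩

lemma tendsto_of_initialConditions {x : ℝ → ℝ} (hx : InitialConditions x) :
    Tendsto x (𝓝[>] 0) (𝓝 0) := by
  have h1 : Tendsto (fun s : ℝ => 2 * s) (𝓝[>] 0) (𝓝 0) := by
    have : Continuous fun s : ℝ => 2 * s := by fun_prop
    simpa using (this.tendsto 0).mono_left (nhdsWithin_le_nhds (s := Ioi 0))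
  have h2 := (hx.2.mul h1)
  rw [mul_zero] at h2
  have h3 : Tendsto (fun s => √(x s ^ 2)) (𝓝[>] 0) (𝓝 √0) := by
    refine (Real.continuous_sqrt.tendsto 0).comp (h2.congr' ?_)
    filter_upwards [self_mem_nhdsWithin] with s hs
    have : s ≠ 0 := ne_of_gt hs
    field_simp
  simp only [Real.sqrt_sq_eq_abs, Real.sqrt_zero] at h3
  exact tendsto_zero_iff_abs_tendsto_zero _ |>.2 h3

lemma initialConditions_explicitSolution {ε : ℝ} (hε : ε ^ 2 = 1) (hδ : 0 < δ)
    (hf : AnalyticOnNhd ℝ f (Ico 0 δ)) : InitialConditions (explicitSolution ε f) := by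
  refine ⟨by simp [explicitSolution], ?_⟩
  have h := (tendsto_explicitSolution_div ε hδ hf).pow 2
  rw [hε] at h
  refine h.congr' ?_
  filter_upwards [self_mem_nhdsWithin] with s hs
  have hs' : 0 < s := hs
  rw [div_pow, Real.sq_sqrt (by positivity)]

lemma IsAnalyticSolution.congr {x y : ℝ → ℝ} (hx : IsAnalyticSolution f x δ)
    (h : EqOn y x (Ioo 0 δ)) : IsAnalyticSolution f y δ := by
  have hloc : ∀ s ∈ Ioo 0 δ, y =ᶠ[𝓝 s] x := fun s hs => by
    filter_upwards [isOpen_Ioo.mem_nhds hs] with t ht using h ht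
  refine ⟨fun s hs => (hx.1 s hs).congr (hloc s hs).symm, fun s hs => ?_⟩
  rw [(hloc s hs).deriv.deriv_eq, (hloc s hs).deriv_eq]
  exact hx.2 s hs

lemma InitialConditions.congr {x y : ℝ → ℝ} (hδ : 0 < δ) (hx : InitialConditions x)
    (h : EqOn y x (Ico 0 δ)) : InitialConditions y := by
  refine ⟨by rw [h ⟨le_rfl, hδ⟩, hx.1], hx.2.congr' ?_⟩
  filter_upwards [Ioo_mem_nhdsGT hδ] with s hs
  rw [h ⟨hs.1.le, hs.2⟩]

/-- A solution differs from the one with `ε = 1` by `C √(2s) + D`. Letting `s → 0` gives `D = 0`,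
and the limit of `x² / (2s)` gives `(1 + C)² = 1`; the sign is then `ε = 1 + C`. -/
theorem isAnalyticSolution_and_initialConditions_iff (hδ : 0 < δ)
    (hf : AnalyticOnNhd ℝ f (Ico 0 δ)) (x : ℝ → ℝ) :
    (IsAnalyticSolution f x δ ∧ InitialConditions x) ↔
      (EqOn x (explicitSolution 1 f) (Ico 0 δ) ∨ EqOn x (explicitSolution (-1) f) (Ico 0 δ)) := by
  constructor
  · rintro ⟨hx, hi⟩
    obtain ⟨C, D, hCD⟩ := hx.exists_sub_eq (isAnalyticSolution_explicitSolution 1 hf)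
    have hi1 := initialConditions_explicitSolution (ε := 1) (by norm_num) hδ hf
    have hsq : Tendsto (fun s : ℝ => √(2 * s)) (𝓝[>] 0) (𝓝 0) := by
      have : Continuous fun s : ℝ => √(2 * s) := by fun_prop
      simpa using (this.tendsto 0).mono_left (nhdsWithin_le_nhds (s := Ioi 0))
    have hD : D = 0 := by
      have h1 := ((tendsto_of_initialConditions hi).sub (tendsto_of_initialConditions hi1)).sub
        (hsq.const_mul C)
      have h2 : Tendsto (fun _ : ℝ => D) (𝓝[>] 0) (𝓝 (0 - 0 - C * 0)) := by
        refine h1.congr' ?_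
        filter_upwards [Ioo_mem_nhdsGT hδ] with s hs
        linarith [hCD s hs]
      simpa using tendsto_nhds_unique tendsto_const_nhds h2
    have hC : (1 + C) ^ 2 = 1 := by
      have h1 := ((tendsto_explicitSolution_div 1 hδ hf).add_const C).pow 2
      refine tendsto_nhds_unique (h1.congr' ?_) hi.2
      filter_upwards [Ioo_mem_nhdsGT hδ] with s hs
      have hs0 : 0 < s := hs.1
      have hne : √(2 * s) ≠ 0 := by positivity
      have : x s = explicitSolution 1 f s + C * √(2 * s) := by linarith [hCD s hs]
      rw [this, ← Real.sq_sqrt (show 0 ≤ 2 * s by positivity), Real.sqrt_sq (by positivity)]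
      field_simp
    have hx' : ∀ s ∈ Ico 0 δ, x s = explicitSolution (1 + C) f s := fun s hs => by
      rcases hs.1.eq_or_lt with rfl | h0
      · simp [hi.1, explicitSolution]
      · have := hCD s ⟨h0, hs.2⟩
        rw [hD] at this
        simp only [explicitSolution] at this ⊢
        linarith
    rw [sq, mul_self_eq_one_iff] at hC
    rcases hC with h | h
    · left; rwa [h] at hx'
    · right; rwa [h] at hx'
  · have key : ∀ ε : ℝ, ε ^ 2 = 1 → EqOn x (explicitSolution ε f) (Ico 0 δ) →
        IsAnalyticSolution f x δ ∧ InitialConditions x := fun ε hε h =>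
      ⟨(isAnalyticSolution_explicitSolution ε hf).congr (h.mono Ioo_subset_Ico_self),
        (initialConditions_explicitSolution hε hδ hf).congr hδ h⟩
    rintro (h | h)
    · exact key 1 (by norm_num) h
    · exact key (-1) (by norm_num) h

end

/-! ### The energy coordinate `u = ± √(2 G(x))` and its inverse -/

/-- `X` is an analytic parametrization of a neighbourhood of the origin by the signed square root
`u` of twice the energy: `X(u) = u + O(u²)` is increasing and `(u² / 2)' = (G(X(u)))'`. -/
structure IsEnergyParam (g X : ℝ → ℝ) (R : ℝ) : Prop where
  pos : 0 < R
  analytic : AnalyticOnNhd ℝ X (Ioo (-R) R)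
  zero : X 0 = 0
  deriv_zero : deriv X 0 = 1
  deriv_pos : ∀ u ∈ Ioo (-R) R, 0 < deriv X u
  deriv_mul : ∀ u ∈ Ioo (-R) R, deriv X u * g (X u) = u
  analyticAt : ∀ u ∈ Ioo (-R) R, AnalyticAt ℝ g (X u)

lemma IsEnergyParam.zero_mem {g X : ℝ → ℝ} {R : ℝ} (h : IsEnergyParam g X R) :
    (0 : ℝ) ∈ Ioo (-R) R := ⟨neg_lt_zero.2 h.pos, h.pos⟩

/-- The signed square root of twice the potential. -/
noncomputable def energyCoord (g : ℝ → ℝ) (x : ℝ) : ℝ :=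
  if 0 ≤ x then √(2 * potential g x) else -√(2 * potential g x)

/-- The inverse of the energy coordinate, glued from the two branches. -/
noncomputable def energyParam (g : ℝ → ℝ) (a b u : ℝ) : ℝ :=
  if 0 ≤ u then rightBranch g b (u ^ 2 / 2) else leftBranch g a (u ^ 2 / 2)

section

variable {g : ℝ → ℝ} {a b c : ℝ}

/-- The points of analyticity of `g` form an open set containing `[a, b]`, so the two-sided
derivative exists at the endpoints as well. -/
lemma hasDerivAt_potential (hg : AnalyticOnNhd ℝ g (Icc a b)) (ha : a < 0) (hb : 0 < b) {x : ℝ}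
    (hx : x ∈ Icc a b) : HasDerivAt (potential g) (g x) x := by
  refine intervalIntegral.integral_hasDerivAt_right (ContinuousOn.intervalIntegrable fun y hy => ?_)
    (ContinuousOn.stronglyMeasurableAtFilter (isOpen_analyticAt ℝ g)
      (fun y hy => ?_) x (hg x hx)) (hg x hx).continuousAt
  · have : y ∈ Icc a b := uIcc_subset_Icc ⟨ha.le, hb.le⟩ hx hy
    exact (hg y this).continuousAt.continuousWithinAt
  · exact AnalyticAt.continuousAt (𝕜 := ℝ) hy |>.continuousWithinAt

lemma analyticAt_potential (hg : AnalyticOnNhd ℝ g (Icc a b)) (ha : a < 0) (hb : 0 < b) {x : ℝ}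
    (hx : x ∈ Ioo a b) : AnalyticAt ℝ (potential g) x := by
  refine analyticAt_of_eventually_hasDerivAt (hg x (Ioo_subset_Icc_self hx)) ?_
  filter_upwards [isOpen_Ioo.mem_nhds hx] with y hy
  exact hasDerivAt_potential hg ha hb (Ioo_subset_Icc_self hy)

lemma potential_zero : potential g 0 = 0 := by simp [potential]

namespace HypothesisH

variable (hH : HypothesisH g a b c) (hg : AnalyticOnNhd ℝ g (Icc a b))
include hH

lemma c_pos : 0 < c := by
  simpa [potential_zero] using hH.potential_lt 0 ⟨hH.a_neg, hH.b_pos⟩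

include hg

lemma continuousOn_potential : ContinuousOn (potential g) (Icc a b) := fun _ hx =>
  (hasDerivAt_potential hg hH.a_neg hH.b_pos hx).continuousAt.continuousWithinAt

lemma strictMonoOn_potential : StrictMonoOn (potential g) (Icc 0 b) := by
  refine strictMonoOn_of_deriv_pos (convex_Icc 0 b)
    ((hH.continuousOn_potential hg).mono (Icc_subset_Icc_left hH.a_neg.le)) fun x hx => ?_
  rw [interior_Icc] at hx
  have hx' : x ∈ Ioo a b := ⟨hH.a_neg.trans hx.1, hx.2⟩
  rw [(hasDerivAt_potential hg hH.a_neg hH.b_pos (Ioo_subset_Icc_self hx')).deriv]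
  exact pos_of_mul_pos_right (hH.sign x hx' hx.1.ne') hx.1.le

lemma strictAntiOn_potential : StrictAntiOn (potential g) (Icc a 0) := by
  refine strictAntiOn_of_deriv_neg (convex_Icc a 0)
    ((hH.continuousOn_potential hg).mono (Icc_subset_Icc_right hH.b_pos.le)) fun x hx => ?_
  rw [interior_Icc] at hx
  have hx' : x ∈ Ioo a b := ⟨hx.1, hx.2.trans hH.b_pos⟩
  rw [(hasDerivAt_potential hg hH.a_neg hH.b_pos (Ioo_subset_Icc_self hx')).deriv]
  have := hH.sign x hx' hx.2.ne
  exact neg_of_mul_pos_right this hx.2.le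

lemma potential_pos {x : ℝ} (hx : x ∈ Icc a b) (h0 : x ≠ 0) : 0 < potential g x := by
  rw [← potential_zero (g := g)]
  rcases h0.lt_or_gt with h | h
  · exact hH.strictAntiOn_potential hg ⟨hx.1, h.le⟩ ⟨hH.a_neg.le, le_rfl⟩ h
  · exact hH.strictMonoOn_potential hg ⟨le_rfl, hH.b_pos.le⟩ ⟨h.le, hx.2⟩ h

lemma rightBranch_spec {s : ℝ} (hs : s ∈ Icc 0 c) :
    rightBranch g b s ∈ Icc 0 b ∧ potential g (rightBranch g b s) = s := by
  have h : s ∈ potential g '' Icc 0 b := by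
    refine intermediate_value_Icc hH.b_pos.le
      ((hH.continuousOn_potential hg).mono (Icc_subset_Icc_left hH.a_neg.le)) ?_
    rwa [potential_zero, hH.potential_b]
  exact ⟨Function.invFunOn_mem h, Function.invFunOn_eq h⟩

lemma leftBranch_spec {s : ℝ} (hs : s ∈ Icc 0 c) :
    leftBranch g a s ∈ Icc a 0 ∧ potential g (leftBranch g a s) = s := by
  have h : s ∈ potential g '' Icc a 0 := by
    refine intermediate_value_Icc' hH.a_neg.le
      ((hH.continuousOn_potential hg).mono (Icc_subset_Icc_right hH.b_pos.le)) ?_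
    rwa [potential_zero, hH.potential_a]
  exact ⟨Function.invFunOn_mem h, Function.invFunOn_eq h⟩

lemma energyCoord_inj {x y : ℝ} (hx : x ∈ Icc a b) (hy : y ∈ Icc a b)
    (h : energyCoord g x = energyCoord g y) : x = y := by
  have hnn : ∀ z ∈ Icc a b, 0 ≤ 2 * potential g z := fun z hz => by
    rcases eq_or_ne z 0 with rfl | h0
    · simp [potential_zero]
    · linarith [hH.potential_pos hg hz h0]
  have hneg : ∀ z ∈ Icc a b, z < 0 → 0 < √(2 * potential g z) := fun z hz h0 =>
    Real.sqrt_pos.2 (by linarith [hH.potential_pos hg hz h0.ne])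
  unfold energyCoord at h
  split_ifs at h with h1 h2 h2
  · rw [Real.sqrt_inj (hnn x hx) (hnn y hy)] at h
    exact (hH.strictMonoOn_potential hg).injOn ⟨h1, hx.2⟩ ⟨h2, hy.2⟩ (by linarith)
  · linarith [hneg y hy (not_le.1 h2), Real.sqrt_nonneg (2 * potential g x)]
  · linarith [hneg x hx (not_le.1 h1), Real.sqrt_nonneg (2 * potential g y)]
  · rw [neg_inj, Real.sqrt_inj (hnn x hx) (hnn y hy)] at h
    exact (hH.strictAntiOn_potential hg).injOn ⟨hx.1, (not_le.1 h1).le⟩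
      ⟨hy.1, (not_le.1 h2).le⟩ (by linarith)

omit hg in
lemma half_sq_mem {u : ℝ} (hu : u ∈ Ioo (-√(2 * c)) √(2 * c)) : u ^ 2 / 2 ∈ Ico 0 c := by
  have h := sq_lt_sq' hu.1 hu.2
  rw [Real.sq_sqrt (by linarith [hH.c_pos])] at h
  exact ⟨by positivity, by linarith⟩

lemma energyParam_spec {u : ℝ} (hu : u ∈ Ioo (-√(2 * c)) √(2 * c)) :
    energyParam g a b u ∈ Ioo a b ∧ potential g (energyParam g a b u) = u ^ 2 / 2 ∧
      (0 ≤ u → 0 ≤ energyParam g a b u) ∧ (u < 0 → energyParam g a b u ≤ 0) := by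
  have hs := hH.half_sq_mem hu
  have hs' := Ico_subset_Icc_self hs
  have hI : ∀ z ∈ Icc a b, potential g z = u ^ 2 / 2 → z ∈ Ioo a b := fun z hz h => by
    refine ⟨hz.1.lt_of_ne ?_, hz.2.lt_of_ne ?_⟩
    · rintro rfl
      linarith [hH.potential_a, hs.2]
    · rintro rfl
      linarith [hH.potential_b, hs.2]
  unfold energyParam
  split_ifs with h
  · obtain ⟨h1, h2⟩ := hH.rightBranch_spec hg hs'
    exact ⟨hI _ ⟨hH.a_neg.le.trans h1.1, h1.2⟩ h2, h2, fun _ => h1.1, fun h' => by linarith⟩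
  · obtain ⟨h1, h2⟩ := hH.leftBranch_spec hg hs'
    exact ⟨hI _ ⟨h1.1, h1.2.trans hH.b_pos.le⟩ h2, h2, fun h' => by linarith, fun _ => h1.2⟩

lemma energyCoord_energyParam {u : ℝ} (hu : u ∈ Ioo (-√(2 * c)) √(2 * c)) :
    energyCoord g (energyParam g a b u) = u := by
  obtain ⟨-, h2, h3, h4⟩ := hH.energyParam_spec hg hu
  rw [energyCoord, h2, show 2 * (u ^ 2 / 2) = u ^ 2 by ring, Real.sqrt_sq_eq_abs]
  rcases lt_or_ge u 0 with h | h
  · have hne : energyParam g a b u ≠ 0 := fun h0 => by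
      rw [h0, potential_zero] at h2
      nlinarith
    rw [if_neg (not_le.2 ((h4 h).lt_of_ne hne)), abs_of_neg h, neg_neg]
  · rw [if_pos (h3 h), abs_of_nonneg h]

lemma energyCoord_mem {x : ℝ} (hx : x ∈ Ioo a b) :
    energyCoord g x ∈ Ioo (-√(2 * c)) √(2 * c) := by
  have h : √(2 * potential g x) < √(2 * c) :=
    Real.sqrt_lt_sqrt (by
      rcases eq_or_ne x 0 with rfl | h0
      · simp [potential_zero]
      · linarith [hH.potential_pos hg (Ioo_subset_Icc_self hx) h0])
      (by linarith [hH.potential_lt x hx])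
  have h0 := Real.sqrt_nonneg (2 * potential g x)
  unfold energyCoord
  split_ifs
  · exact ⟨by linarith, h⟩
  · exact ⟨by linarith, by linarith⟩

lemma energyParam_energyCoord {x : ℝ} (hx : x ∈ Ioo a b) :
    energyParam g a b (energyCoord g x) = x := by
  have hu := hH.energyCoord_mem hg hx
  exact hH.energyCoord_inj hg (Ioo_subset_Icc_self (hH.energyParam_spec hg hu).1)
    (Ioo_subset_Icc_self hx) (hH.energyCoord_energyParam hg hu)

/-- The potential vanishes to order two, so it is `x² k(x)`, and the sign in the definition turns
`|x| √(2k)` into the analytic function `x √(2k)`. -/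
lemma energyCoord_at_zero (hg0 : g 0 = 0) (hg1 : deriv g 0 = 1) :
    AnalyticAt ℝ (energyCoord g) 0 ∧ deriv (energyCoord g) 0 = 1 := by
  have h0 : (0 : ℝ) ∈ Ioo a b := ⟨hH.a_neg, hH.b_pos⟩
  have hGa := analyticAt_potential hg hH.a_neg hH.b_pos h0
  have hord : ((2 : ℕ) : ℕ∞) ≤ analyticOrderAt (potential g) 0 := by
    rw [natCast_le_analyticOrderAt_iff_iteratedDeriv_eq_zero hGa]
    intro i hi
    interval_cases i
    · simp [potential_zero]
    · simp [(hasDerivAt_potential hg hH.a_neg hH.b_pos (Ioo_subset_Icc_self h0)).deriv, hg0]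
  obtain ⟨k, hk, hGk⟩ := (natCast_le_analyticOrderAt hGa).1 hord
  simp only [sub_zero, smul_eq_mul] at hGk
  have hk0 : k 0 = 1 / 2 := by
    -- Differentiating `x² k` shows `g'(0) = 2 k(0)`.
    have hgk : g =ᶠ[𝓝 0] fun x => x * (2 * k x + x * deriv k x) := by
      filter_upwards [isOpen_Ioo.mem_nhds h0, hGk.eventually_nhds, hk.eventually_analyticAt]
        with x hx hxk hka
      have h1 := hasDerivAt_potential hg hH.a_neg hH.b_pos (Ioo_subset_Icc_self hx)
      have h2 := (((hasDerivAt_id x).pow 2).mul hka.differentiableAt.hasDerivAt)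
      have h3 := h1.unique (h2.congr_of_eventuallyEq hxk)
      rw [h3]
      simp
      ring
    have hm : DifferentiableAt ℝ (fun x => 2 * k x + x * deriv k x) 0 :=
      (hk.differentiableAt.const_mul 2).add (differentiableAt_id.mul hk.deriv.differentiableAt)
    have h4 := (hasDerivAt_id (0 : ℝ)).mul hm.hasDerivAt
    have h5 := (h4.congr_of_eventuallyEq hgk).deriv
    rw [hg1] at h5
    simp at h5
    linarith
  have hsqrt : AnalyticAt ℝ (fun x => √(2 * k x)) 0 :=
    (analyticAt_sqrt (x := 2 * k 0) (by rw [hk0]; norm_num)).comp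
      (f := fun x => 2 * k x) (analyticAt_const.fun_mul hk)
  have hU : energyCoord g =ᶠ[𝓝 0] fun x => x * √(2 * k x) := by
    filter_upwards [hGk] with x hx
    rw [energyCoord, hx, show 2 * (x ^ 2 * k x) = x ^ 2 * (2 * k x) by ring,
      Real.sqrt_mul (sq_nonneg x), Real.sqrt_sq_eq_abs]
    split_ifs with h
    · rw [abs_of_nonneg h]
    · rw [abs_of_neg (not_le.1 h)]
      ring
  refine ⟨(analyticAt_id.fun_mul hsqrt).congr hU.symm, ?_⟩
  have h4 := (hasDerivAt_id (0 : ℝ)).mul hsqrt.differentiableAt.hasDerivAt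
  rw [(h4.congr_of_eventuallyEq hU).deriv]
  simp [hk0]

/-- Away from `0` the potential is positive and the square root is harmless; differentiating `G = U²
/ 2` gives `U U' = g ≠ 0`, hence `U' ≠ 0`. -/
lemma analyticAt_energyCoord (hg0 : g 0 = 0) (hg1 : deriv g 0 = 1) {x : ℝ} (hx : x ∈ Ioo a b) :
    AnalyticAt ℝ (energyCoord g) x ∧ deriv (energyCoord g) x ≠ 0 := by
  rcases eq_or_ne x 0 with rfl | hx0
  · obtain ⟨h1, h2⟩ := hH.energyCoord_at_zero hg hg0 hg1
    exact ⟨h1, by rw [h2]; norm_num⟩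
  have hGa := analyticAt_potential hg hH.a_neg hH.b_pos hx
  have hpos := hH.potential_pos hg (Ioo_subset_Icc_self hx) hx0
  have hsqrt : AnalyticAt ℝ (fun x => √(2 * potential g x)) x :=
    (analyticAt_sqrt (x := 2 * potential g x) (by positivity)).comp
      (f := fun x => 2 * potential g x) (analyticAt_const.fun_mul hGa)
  have hU : AnalyticAt ℝ (energyCoord g) x := by
    rcases hx0.lt_or_gt with h | h
    · refine hsqrt.fun_neg.congr ?_
      filter_upwards [Iio_mem_nhds h] with y hy
      rw [energyCoord, if_neg (not_le.2 hy)]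
    · refine hsqrt.congr ?_
      filter_upwards [Ioi_mem_nhds h] with y hy
      rw [energyCoord, if_pos (le_of_lt hy)]
  refine ⟨hU, fun h0 => ?_⟩
  have hsq : potential g =ᶠ[𝓝 x] fun y => energyCoord g y ^ 2 / 2 := by
    filter_upwards [hGa.continuousAt.eventually (lt_mem_nhds hpos)] with y hy
    have : energyCoord g y ^ 2 = 2 * potential g y := by
      rw [energyCoord]
      split_ifs
      · exact Real.sq_sqrt (by positivity)
      · rw [neg_sq]
        exact Real.sq_sqrt (by positivity)
    rw [this]
    ring
  have h1 := hasDerivAt_potential hg hH.a_neg hH.b_pos (Ioo_subset_Icc_self hx)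
  have h2 := ((hU.differentiableAt.hasDerivAt.pow 2).div_const 2).congr_of_eventuallyEq hsq
  have h3 := h1.unique h2
  rw [h0] at h3
  have := hH.sign x hx hx0
  rw [h3] at this
  simp at this

theorem isEnergyParam (hg0 : g 0 = 0) (hg1 : deriv g 0 = 1) :
    IsEnergyParam g (energyParam g a b) √(2 * c) := by
  have hR : 0 < √(2 * c) := Real.sqrt_pos.2 (by linarith [hH.c_pos])
  have h0R : (0 : ℝ) ∈ Ioo (-√(2 * c)) √(2 * c) := ⟨by linarith, hR⟩
  have hmem := fun u hu => (hH.energyParam_spec hg (u := u) hu).1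
  have hana : AnalyticOnNhd ℝ (energyParam g a b) (Ioo (-√(2 * c)) √(2 * c)) := fun u hu => by
    obtain ⟨hU, hU'⟩ := hH.analyticAt_energyCoord hg hg0 hg1 (hmem u hu)
    -- `X ∘ U` is the identity near the point and `U' ≠ 0`, so `X` is analytic at the image.
    have := (analyticAt_comp_iff_of_deriv_ne_zero (g := energyParam g a b) hU hU').1 ?_
    · rwa [hH.energyCoord_energyParam hg hu] at this
    · refine (analyticAt_id (𝕜 := ℝ)).congr ?_
      filter_upwards [isOpen_Ioo.mem_nhds (hmem u hu)] with x hx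
      exact (hH.energyParam_energyCoord hg hx).symm
  have hX0 : energyParam g a b 0 = 0 := by
    have h := hH.energyParam_energyCoord hg (x := 0) ⟨hH.a_neg, hH.b_pos⟩
    simpa [energyCoord, potential_zero] using h
  have hmul : ∀ u ∈ Ioo (-√(2 * c)) √(2 * c),
      deriv (energyParam g a b) u * g (energyParam g a b u) = u := fun u hu => by
    have h1 := (hasDerivAt_potential hg hH.a_neg hH.b_pos
      (Ioo_subset_Icc_self (hmem u hu))).comp u (hana u hu).differentiableAt.hasDerivAt
    have h2 : (potential g ∘ energyParam g a b) =ᶠ[𝓝 u] fun v => v ^ 2 / 2 := by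
      filter_upwards [isOpen_Ioo.mem_nhds hu] with v hv
      exact (hH.energyParam_spec hg hv).2.1
    have h3 := h1.unique ((((hasDerivAt_id u).pow 2).div_const 2).congr_of_eventuallyEq h2)
    rw [mul_comm, h3]
    simp
  have hd0 : deriv (energyParam g a b) 0 = 1 := by
    obtain ⟨hU, hU'⟩ := hH.energyCoord_at_zero hg hg0 hg1
    have h1 : HasDerivAt (energyCoord g) 1 (energyParam g a b 0) := by
      rw [hX0, ← hU']
      exact hU.differentiableAt.hasDerivAt
    have h2 := h1.comp 0 (hana 0 h0R).differentiableAt.hasDerivAt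
    have h3 : (energyCoord g ∘ energyParam g a b) =ᶠ[𝓝 0] id := by
      filter_upwards [isOpen_Ioo.mem_nhds h0R] with v hv
      exact hH.energyCoord_energyParam hg hv
    simpa using h2.unique ((hasDerivAt_id 0).congr_of_eventuallyEq h3)
  refine ⟨hR, hana, hX0, hd0, fun u hu => ?_, hmul,
    fun u hu => hg _ (Ioo_subset_Icc_self (hmem u hu))⟩
  rcases eq_or_ne u 0 with rfl | hu0
  · rw [hd0]; norm_num
  obtain ⟨h1, h2, h3, h4⟩ := hH.energyParam_spec hg hu
  have hne : energyParam g a b u ≠ 0 := fun h => by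
    rw [h, potential_zero] at h2
    have : 0 < u ^ 2 := by positivity
    linarith
  have hs := hH.sign _ h1 hne
  -- `g(X(u))` has the sign of `u`, so `X'(u) g(X(u)) = u` forces `X'(u) > 0`.
  have hm := hmul u hu
  rcases hu0.lt_or_gt with h | h
  · have hg' := neg_of_mul_pos_right hs (h4 h)
    by_contra hd
    have := mul_nonneg_of_nonpos_of_nonpos (not_lt.1 hd) hg'.le
    linarith
  · have hg' := pos_of_mul_pos_right hs (h3 h.le)
    by_contra hd
    have := mul_nonpos_of_nonpos_of_nonneg (not_lt.1 hd) hg'.le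
    linarith

omit hH hg in
lemma rightBranch_eq {s : ℝ} (hs : 0 ≤ s) :
    rightBranch g b s = energyParam g a b (1 * √(2 * s)) := by
  rw [one_mul, energyParam, if_pos (Real.sqrt_nonneg _), Real.sq_sqrt (by positivity)]
  congr 1
  ring

lemma leftBranch_eq {s : ℝ} (hs : 0 ≤ s) :
    leftBranch g a s = energyParam g a b (-1 * √(2 * s)) := by
  -- At `u = 0` the definition of `energyParam` uses the right branch, so both branches must be seen
  -- to vanish there.
  rcases hs.eq_or_lt with rfl | h
  · have h1 := hH.rightBranch_spec hg (s := 0) ⟨le_rfl, hH.c_pos.le⟩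
    have h2 := hH.leftBranch_spec hg (s := 0) ⟨le_rfl, hH.c_pos.le⟩
    have h3 : rightBranch g b 0 = 0 := by
      by_contra h
      have := hH.potential_pos hg ⟨hH.a_neg.le.trans h1.1.1, h1.1.2⟩ h
      linarith [h1.2]
    have h4 : leftBranch g a 0 = 0 := by
      by_contra h
      have := hH.potential_pos hg ⟨h2.1.1, h2.1.2.trans hH.b_pos.le⟩ h
      linarith [h2.2]
    simp [energyParam, h3, h4]
  · have hpos : 0 < √(2 * s) := Real.sqrt_pos.2 (by positivity)
    rw [energyParam, if_neg (by linarith), mul_pow, Real.sq_sqrt (by positivity)]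
    congr 1
    ring

end HypothesisH

end

namespace IsEnergyParam

/-! ### The linear equation in terms of the energy coordinate -/

variable {g X : ℝ → ℝ} {R : ℝ}

lemma mul_mem (ε : ℝ) (hε : ε ^ 2 = 1) {u : ℝ} (hu : u ∈ Ioo (-R) R) : ε * u ∈ Ioo (-R) R := by
  rw [sq, mul_self_eq_one_iff] at hε
  rcases hε with rfl | rfl
  · simpa using hu
  · exact ⟨by linarith [hu.2], by linarith [hu.1]⟩

lemma sqrt_mem {δ : ℝ} (hδ : √(2 * δ) ≤ R) {s : ℝ} (hs : s ∈ Ioo 0 δ) :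
    √(2 * s) ∈ Ioo 0 R := by
  refine ⟨Real.sqrt_pos.2 (by linarith [hs.1]), lt_of_lt_of_le ?_ hδ⟩
  exact Real.sqrt_lt_sqrt (by linarith [hs.1]) (by linarith [hs.2])

lemma sqrt_mem' {δ : ℝ} (hδ : √(2 * δ) ≤ R) {s : ℝ} (hs : s ∈ Ioo 0 δ) :
    √(2 * s) ∈ Ioo (-R) R :=
  have h := sqrt_mem hδ hs
  ⟨by linarith [h.1, h.2], h.2⟩

variable (h : IsEnergyParam g X R)
include h

lemma analyticOnNhd_comp_sqrt {ε : ℝ} (hε : ε ^ 2 = 1) {δ : ℝ} (hδ : √(2 * δ) ≤ R) :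
    AnalyticOnNhd ℝ (fun s => X (ε * √(2 * s))) (Ioo 0 δ) := fun _ hs =>
  (h.analytic _ (mul_mem ε hε (sqrt_mem' hδ hs))).comp (f := fun s => ε * √(2 * s))
    (analyticAt_const.fun_mul (analyticAt_sqrt_two_mul hs.1))

/-- The left-hand side of the equation is `X''` in terms of the energy coordinate. -/
lemma equation_comp_sqrt {ε : ℝ} (hε : ε ^ 2 = 1) {δ : ℝ} (hδ : √(2 * δ) ≤ R) {s : ℝ}
    (hs : s ∈ Ioo 0 δ) :
    2 * s * deriv (deriv fun s => X (ε * √(2 * s))) s + deriv (fun s => X (ε * √(2 * s))) s =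
      deriv (deriv X) (ε * √(2 * s)) := by
  have hin : ∀ t ∈ Ioo 0 δ, HasDerivAt (fun s => ε * √(2 * s)) (ε * (1 / √(2 * t))) t :=
    fun t ht => (hasDerivAt_sqrt_two_mul ht.1).const_mul ε
  have h1 : ∀ t ∈ Ioo 0 δ, HasDerivAt (fun s => X (ε * √(2 * s)))
      (deriv X (ε * √(2 * t)) * (ε * (1 / √(2 * t)))) t := fun t ht =>
    (h.analytic _ (mul_mem ε hε (sqrt_mem' hδ ht))).differentiableAt.hasDerivAt.comp
      (h := fun s => ε * √(2 * s)) t (hin t ht)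
  have h2 : deriv (fun s => X (ε * √(2 * s))) =ᶠ[𝓝 s]
      fun t => deriv X (ε * √(2 * t)) * (ε * (1 / √(2 * t))) := by
    filter_upwards [isOpen_Ioo.mem_nhds hs] with t ht
    exact (h1 t ht).deriv
  have hpos : 0 < √(2 * s) := (sqrt_mem hδ hs).1
  have h3 := ((h.analytic _ (mul_mem ε hε (sqrt_mem' hδ hs))).deriv.differentiableAt.hasDerivAt.comp
    (h := fun s => ε * √(2 * s)) s (hin s hs)).mul
    (((hasDerivAt_const s (1 : ℝ)).div (hasDerivAt_sqrt_two_mul hs.1) hpos.ne').const_mul ε)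
  rw [(h3.congr_of_eventuallyEq h2).deriv, h2.self_of_nhds]
  have hsq : √(2 * s) ^ 2 = 2 * s := Real.sq_sqrt (by linarith [hs.1])
  simp only [Function.comp, Pi.div_apply]
  generalize √(2 * s) = w at hpos hsq ⊢
  generalize deriv (deriv X) (ε * w) = D₂
  generalize deriv X (ε * w) = D₁
  rw [← hsq]
  field_simp
  linear_combination (w * D₂) * hε

lemma isAnalyticSolution_iff {ε : ℝ} (hε : ε ^ 2 = 1) {δ : ℝ} (hδ : √(2 * δ) ≤ R) (f : ℝ → ℝ) :
    IsAnalyticSolution f (fun s => X (ε * √(2 * s))) δ ↔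
      ∀ s ∈ Ioo 0 δ, deriv (deriv X) (ε * √(2 * s)) = f s := by
  refine ⟨fun H s hs => ?_, fun H => ⟨h.analyticOnNhd_comp_sqrt hε hδ, fun s hs => ?_⟩⟩
  · rw [← h.equation_comp_sqrt hε hδ hs, H.2 s hs]
  · rw [h.equation_comp_sqrt hε hδ hs, H s hs]

/-- This is `X'(0) = 1`. It keeps the sign that the squared initial condition loses. -/
lemma tendsto_comp_sqrt_div {ε : ℝ} (hε : ε ^ 2 = 1) :
    Tendsto (fun s => X (ε * √(2 * s)) / √(2 * s)) (𝓝[>] 0) (𝓝 ε) := by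
  have h0 : ε ≠ 0 := by rintro rfl; norm_num at hε
  have hd := (h.analytic 0 h.zero_mem).differentiableAt.hasDerivAt
  rw [h.deriv_zero] at hd
  have hl := hd.tendsto_slope_zero
  have ht : Tendsto (fun s : ℝ => ε * √(2 * s)) (𝓝[>] 0) (𝓝[≠] 0) := by
    refine tendsto_nhdsWithin_iff.2 ⟨?_, ?_⟩
    · have : Continuous fun s : ℝ => ε * √(2 * s) := by fun_prop
      simpa using (this.tendsto 0).mono_left (nhdsWithin_le_nhds (s := Ioi 0))
    · filter_upwards [self_mem_nhdsWithin] with s hs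
      exact mul_ne_zero h0 (Real.sqrt_pos.2 (by linarith [mem_Ioi.1 hs])).ne'
  have := (hl.comp ht).const_mul ε
  rw [mul_one] at this
  refine this.congr fun s => ?_
  simp only [Function.comp, zero_add, h.zero, sub_zero, smul_eq_mul, mul_inv]
  field_simp

lemma initialConditions_comp_sqrt {ε : ℝ} (hε : ε ^ 2 = 1) :
    InitialConditions (fun s => X (ε * √(2 * s))) := by
  refine ⟨by simp [h.zero], ?_⟩
  have := (h.tendsto_comp_sqrt_div hε).pow 2
  rw [hε] at this
  refine this.congr' ?_
  filter_upwards [self_mem_nhdsWithin] with s hs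
  rw [div_pow, Real.sq_sqrt (by linarith [mem_Ioi.1 hs])]

/-- One branch gives `X''(ε u) = f(u² / 2)` for small `u > 0` only; both sides are analytic at `0`,
so the identity holds on both sides of `0`, where the right-hand side is even. -/
lemma even_of_isAnalyticSolution {ε : ℝ} (hε : ε ^ 2 = 1) {δ : ℝ} (h0 : 0 < δ)
    (hδ : √(2 * δ) ≤ R) {f : ℝ → ℝ} (hf : AnalyticAt ℝ f 0)
    (H : IsAnalyticSolution f (fun s => X (ε * √(2 * s))) δ) :
    ∀ᶠ u in 𝓝 0, deriv (deriv X) (-u) = deriv (deriv X) u := by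
  rw [h.isAnalyticSolution_iff hε hδ] at H
  have hX := (h.analytic 0 h.zero_mem).deriv.deriv
  have h1 : AnalyticAt ℝ (fun u => deriv (deriv X) (ε * u)) 0 :=
    AnalyticAt.comp (g := deriv (deriv X)) (f := fun u => ε * u) (by simpa using hX)
      (analyticAt_const.fun_mul analyticAt_id)
  have h2 : AnalyticAt ℝ (fun u : ℝ => f (u ^ 2 / 2)) 0 :=
    AnalyticAt.comp (g := f) (f := fun u => u ^ 2 / 2) (by simpa using hf) (by fun_prop)
  have hev : ∀ᶠ u in 𝓝 (0 : ℝ), deriv (deriv X) (ε * u) = f (u ^ 2 / 2) := by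
    refine (h1.frequently_eq_iff_eventually_eq h2).1 ?_
    refine Frequently.filter_mono ?_ (nhdsGT_le_nhdsNE (0 : ℝ))
    refine Eventually.frequently ?_
    filter_upwards [Ioo_mem_nhdsGT (show 0 < √(2 * δ) by positivity)] with u hu
    have hu2 : u ^ 2 < 2 * δ := by
      have := sq_lt_sq' (by linarith [hu.1, hu.2]) hu.2
      rwa [Real.sq_sqrt (by positivity)] at this
    have h3 := H (u ^ 2 / 2) ⟨by have := hu.1; positivity, by linarith⟩
    rwa [show 2 * (u ^ 2 / 2) = u ^ 2 by ring, Real.sqrt_sq hu.1.le] at h3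
  have hneg : Tendsto (fun u : ℝ => -u) (𝓝 0) (𝓝 0) := by
    simpa using (continuous_neg (G := ℝ)).tendsto 0
  filter_upwards [hev, hneg.eventually hev] with u h3 h4
  rw [neg_sq, ← h3] at h4
  rw [sq, mul_self_eq_one_iff] at hε
  rcases hε with rfl | rfl
  · simpa using h4
  · simpa using h4.symm

lemma exists_isAnalyticSolution_of_even
    (heven : ∀ᶠ u in 𝓝 0, deriv (deriv X) (-u) = deriv (deriv X) u) {δ : ℝ}
    (hδ : √(2 * δ) ≤ R) :
    ∃ f : ℝ → ℝ, AnalyticOnNhd ℝ f (Ico 0 δ) ∧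
      IsAnalyticSolution f (fun s => X (1 * √(2 * s))) δ ∧
      IsAnalyticSolution f (fun s => X (-1 * √(2 * s))) δ := by
  have hX := h.analytic.deriv.deriv
  -- Evenness spreads from a neighbourhood of `0` to the whole interval, so that the left branch
  -- satisfies the equation up to `δ`.
  have hglob : EqOn (fun u => deriv (deriv X) (-u)) (deriv (deriv X)) (Ioo (-R) R) := by
    refine AnalyticOnNhd.eqOn_of_preconnected_of_eventuallyEq (fun u hu => ?_) hX
      isPreconnected_Ioo h.zero_mem heven
    exact AnalyticAt.comp (g := deriv (deriv X)) (f := fun u => -u)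
      (hX _ ⟨by linarith [hu.2], by linarith [hu.1]⟩) analyticAt_id.fun_neg
  obtain ⟨f₀, hf₀, hEf⟩ := exists_analyticAt_of_even (hX 0 h.zero_mem) heven
  have ht : Tendsto (fun s : ℝ => √(2 * s)) (𝓝 0) (𝓝 0) := by
    have : Continuous (fun s : ℝ => √(2 * s)) := by fun_prop
    simpa using this.tendsto 0
  obtain ⟨κ, hκ, hκf⟩ := Metric.eventually_nhds_iff_ball.1 (ht.eventually hEf)
  simp only [Real.ball_eq_Ioo, zero_sub, zero_add] at hκf
  -- `X''(√(2s))` is the required value for every `s > 0`, but analyticity at `0` is visible only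
  -- from `f₀`; the two agree on `(0, κ)`.
  set f : ℝ → ℝ := fun s => if s < κ then f₀ s else deriv (deriv X) √(2 * s) with hf
  have hfs : ∀ s, 0 < s → f s = deriv (deriv X) √(2 * s) := fun s hs => by
    simp only [hf]
    split_ifs with h1
    · rw [hκf s ⟨by linarith, h1⟩, Real.sq_sqrt (by positivity)]
      congr 1
      ring
    · rfl
  refine ⟨f, fun s hs => ?_, ?_, ?_⟩
  · rcases hs.1.eq_or_lt with rfl | hs0
    · refine hf₀.congr ?_
      filter_upwards [Iio_mem_nhds hκ] with s hs
      exact (if_pos hs).symm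
    · refine AnalyticAt.congr (f := fun s => deriv (deriv X) √(2 * s))
        (AnalyticAt.comp (g := deriv (deriv X)) (f := fun s => √(2 * s))
          (hX _ (sqrt_mem' hδ ⟨hs0, hs.2⟩)) (analyticAt_sqrt_two_mul hs0)) ?_
      filter_upwards [Ioi_mem_nhds hs0] with t ht
      exact (hfs t ht).symm
  · rw [h.isAnalyticSolution_iff (by norm_num) hδ]
    intro s hs
    rw [hfs s hs.1, one_mul]
  · rw [h.isAnalyticSolution_iff (by norm_num) hδ]
    intro s hs
    rw [hfs s hs.1, neg_one_mul]
    exact hglob (sqrt_mem' hδ hs)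

end IsEnergyParam

/-! ### Trajectories and their periods -/

/-- Trajectories are unique as long as `g` is analytic along one of them. -/
lemma IsTrajectory.eq_of_apply_zero_eq {g : ℝ → ℝ} {γ₁ γ₂ : ℝ → ℝ × ℝ} (h₁ : IsTrajectory g γ₁)
    (h₂ : IsTrajectory g γ₂) (h0 : γ₁ 0 = γ₂ 0) (hg : ∀ t, AnalyticAt ℝ g (γ₁ t).1) : γ₁ = γ₂ := by
  have hc₁ : Continuous γ₁ := continuous_iff_continuousAt.2 fun t => (h₁ t).continuousAt
  have hc₂ : Continuous γ₂ := continuous_iff_continuousAt.2 fun t => (h₂ t).continuousAt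
  -- The set of coincidence is closed, and open by local uniqueness. Local Lipschitz bounds are
  -- needed only along `γ₁`, since nothing is known of `g` away from `[a, b]`.
  have hopen : IsOpen {t | γ₁ t = γ₂ t} := by
    refine isOpen_iff_mem_nhds.2 fun t ht => ?_
    have hv : ContDiffAt ℝ 1 (fun p : ℝ × ℝ => (p.2, -g p.1)) (γ₁ t) :=
      contDiffAt_snd.prodMk
        (ContDiffAt.neg (ContDiffAt.comp (γ₁ t) (hg t).contDiffAt contDiffAt_fst))
    obtain ⟨K, s, hs, hK⟩ := hv.exists_lipschitzOnWith
    exact ODE_solution_unique_of_eventually (v := fun _ p => (p.2, -g p.1)) (s := fun _ => s)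
      (Eventually.of_forall fun _ => hK)
      ((hc₁.continuousAt.eventually hs).mono fun τ hτ => ⟨h₁ τ, hτ⟩)
      ((hc₂.continuousAt.eventually (show s ∈ 𝓝 (γ₂ t) from ht ▸ hs)).mono fun τ hτ => ⟨h₂ τ, hτ⟩)
      ht
  have huniv := IsClopen.eq_univ ⟨isClosed_eq hc₁ hc₂, hopen⟩ ⟨0, h0⟩
  exact funext fun t => (huniv ▸ mem_univ t : t ∈ {t | γ₁ t = γ₂ t})

/-- The period of the orbit of energy `r² / 2`. -/
noncomputable def orbitPeriod (X : ℝ → ℝ) (r : ℝ) : ℝ :=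
  ∫ s in (0 : ℝ)..2 * Real.pi, deriv X (r * Real.sin s)

namespace IsEnergyParam

variable {g X : ℝ → ℝ} {R : ℝ}

lemma mul_sin_mem {r : ℝ} (hr : r ∈ Ioo 0 R) (s : ℝ) : r * Real.sin s ∈ Ioo (-R) R := by
  have h1 := mul_le_mul_of_nonneg_left (Real.sin_le_one s) hr.1.le
  have h2 := mul_le_mul_of_nonneg_left (Real.neg_one_le_sin s) hr.1.le
  exact ⟨by linarith [hr.2], by linarith [hr.2]⟩

variable (h : IsEnergyParam g X R)
include h

lemma injOn : InjOn X (Ioo (-R) R) := by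
  refine (strictMonoOn_of_deriv_pos (convex_Ioo _ _) h.analytic.continuousOn fun x hx => ?_).injOn
  rw [interior_Ioo] at hx
  exact h.deriv_pos x hx

lemma continuous_deriv_mul_sin {r : ℝ} (hr : r ∈ Ioo 0 R) :
    Continuous fun s => deriv X (r * Real.sin s) := by
  refine continuous_iff_continuousAt.2 fun s => ?_
  exact ContinuousAt.comp (g := deriv X) (f := fun s => r * Real.sin s)
    (h.analytic _ (mul_sin_mem hr s)).deriv.continuousAt (by fun_prop)

lemma continuous_deriv_neg_mul_sin {r : ℝ} (hr : r ∈ Ioo 0 R) :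
    Continuous fun s => deriv X (-(r * Real.sin s)) :=
  ((h.continuous_deriv_mul_sin hr).comp (continuous_add_const Real.pi)).congr fun s => by
    simp [Real.sin_add_pi]

/-- The orbit of energy `r² / 2`, traversed starting from any of its points. -/
lemma exists_trajectory {r : ℝ} (hr : r ∈ Ioo 0 R) (α : ℝ) :
    ∃ γ : ℝ → ℝ × ℝ, IsTrajectory g γ ∧ γ 0 = (X (r * Real.sin α), r * Real.cos α) ∧
      IsMinimalPeriod γ (orbitPeriod X r) ∧ ∀ t, AnalyticAt ℝ g (γ t).1 := by
  set w : ℝ → ℝ := fun s => deriv X (r * Real.sin s) with hw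
  have hwc : Continuous w := h.continuous_deriv_mul_sin hr
  have hwpos : ∀ s, 0 < w s := fun s => h.deriv_pos _ (mul_sin_mem hr s)
  have hwper : Function.Periodic w (2 * Real.pi) := fun s => by simp [hw]
  -- `Θ` is time as a function of the angle; its inverse `θ` solves `θ' = 1 / X'(r sin θ)`.
  set Θ : ℝ → ℝ := fun φ => ∫ s in (0 : ℝ)..φ, w s with hΘ
  have hΘd : ∀ φ, HasDerivAt Θ (w φ) φ := fun φ => hwc.integral_hasStrictDerivAt 0 φ |>.hasDerivAt
  have hΘmono : StrictMono Θ := strictMono_of_deriv_pos fun φ => by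
    rw [(hΘd φ).deriv]
    exact hwpos φ
  have hΘsurj : Function.Surjective Θ := by
    refine Continuous.surjective
      (continuous_iff_continuousAt.2 fun φ => (hΘd φ).continuousAt) ?_ ?_
    · exact hwper.tendsto_atTop_intervalIntegral_of_pos' (hwc.intervalIntegrable _ _) hwpos
        Real.two_pi_pos
    · exact hwper.tendsto_atBot_intervalIntegral_of_pos' (hwc.intervalIntegrable _ _) hwpos
        Real.two_pi_pos
  have hΘ0 : Θ 0 = 0 := by simp [hΘ]
  have hΘadd : ∀ φ, Θ (φ + 2 * Real.pi) = Θ φ + orbitPeriod X r := fun φ => by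
    have h1 := intervalIntegral.integral_add_adjacent_intervals
      (hwc.intervalIntegrable (μ := MeasureTheory.volume) 0 φ)
      (hwc.intervalIntegrable φ (φ + 2 * Real.pi))
    have h2 := hwper.intervalIntegral_add_eq φ 0
    rw [zero_add] at h2
    rw [hΘ]
    simp only
    rw [← h1, h2]
    rfl
  set e := hΘmono.orderIsoOfSurjective Θ hΘsurj with he
  set θ : ℝ → ℝ := fun t => e.symm t with hθ
  have hΘθ : ∀ t, Θ (θ t) = t := fun t => e.apply_symm_apply t
  have hθΘ : ∀ φ, θ (Θ φ) = φ := fun φ => e.symm_apply_apply φ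
  have hθd : ∀ t, HasDerivAt θ (w (θ t))⁻¹ t := fun t =>
    HasDerivAt.of_local_left_inverse e.symm.continuous.continuousAt (hΘd (θ t)) (hwpos _).ne'
      (Eventually.of_forall hΘθ)
  have hθadd : ∀ t, θ (t + orbitPeriod X r) = θ t + 2 * Real.pi := fun t => by
    rw [← hθΘ (θ t + 2 * Real.pi), hΘadd, hΘθ]
  have hPpos : 0 < orbitPeriod X r := by
    have := hΘadd 0
    rw [hΘ0, zero_add, zero_add] at this
    rw [← this, ← hΘ0]
    exact hΘmono Real.two_pi_pos
  refine ⟨fun t => (X (r * Real.sin (θ (t + Θ α))), r * Real.cos (θ (t + Θ α))),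
    fun t => ?_, by simp [hθΘ], ⟨⟨hPpos, fun t => ?_⟩, fun τ ⟨hτ, hper⟩ => ?_⟩,
    fun t => h.analyticAt _ (mul_sin_mem hr _)⟩
  · have h1 : HasDerivAt (fun t => θ (t + Θ α)) (w (θ (t + Θ α)))⁻¹ t :=
      (hθd (t + Θ α)).comp_add_const t (Θ α)
    have hmem := mul_sin_mem hr (θ (t + Θ α))
    have h2 : HasDerivAt (fun t => X (r * Real.sin (θ (t + Θ α)))) _ t :=
      (h.analytic _ hmem).differentiableAt.hasDerivAt.comp
        (h := fun t => r * Real.sin (θ (t + Θ α))) t (h1.sin.const_mul r)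
    have h3 := h1.cos.const_mul r
    have hmul := h.deriv_mul _ hmem
    have hne := (hwpos (θ (t + Θ α))).ne'
    refine (h2.prodMk h3).congr_deriv (Prod.ext ?_ ?_)
    · simp only [hw] at hne ⊢
      field_simp
    · simp only [hw] at hne ⊢
      rw [neg_mul, mul_neg, neg_inj, ← mul_assoc, ← div_eq_mul_inv, div_eq_iff hne, mul_comm (g _),
        hmul]
  · simp only
    rw [add_right_comm, hθadd, Real.sin_add_two_pi, Real.cos_add_two_pi]
  -- At time `-Θ α` the angle is `0`. After a period `τ` it is `θ τ` with `cos (θ τ) = 1`, hence a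
  -- positive multiple of `2π`, so `τ ≥ Θ(2π)`.
  · have h1 := hper (-Θ α)
    simp only [neg_add_cancel, Prod.mk.injEq] at h1
    rw [show -Θ α + τ + Θ α = τ by ring, ← hΘ0, hθΘ] at h1
    have h2 : Real.cos (θ τ) = 1 := by
      have := h1.2
      rw [Real.cos_zero] at this
      exact mul_left_cancel₀ hr.1.ne' this
    obtain ⟨n, hn⟩ := (Real.cos_eq_one_iff _).1 h2
    have hθpos : 0 < θ τ := by
      rw [← hΘmono.lt_iff_lt, hΘθ, hΘ0]
      exact hτ
    have hn1 : (1 : ℝ) ≤ n := by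
      rw [← hn] at hθpos
      have := pos_of_mul_pos_left hθpos Real.two_pi_pos.le
      have h' : (0 : ℤ) < n := by exact_mod_cast this
      exact_mod_cast h'
    have h3 : 2 * Real.pi ≤ θ τ := by
      rw [← hn]
      nlinarith [Real.two_pi_pos]
    have h4 := hΘmono.monotone h3
    rw [hΘθ] at h4
    exact h4

lemma orbitPeriod_eq {r : ℝ} (hr : r ∈ Ioo 0 R) :
    orbitPeriod X r =
      ∫ s in (0 : ℝ)..Real.pi, (deriv X (r * Real.sin s) + deriv X (-(r * Real.sin s))) := by
  have hc := h.continuous_deriv_mul_sin hr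
  have hc' := h.continuous_deriv_neg_mul_sin hr
  rw [intervalIntegral.integral_add (hc.intervalIntegrable _ _) (hc'.intervalIntegrable _ _),
    orbitPeriod, ← intervalIntegral.integral_add_adjacent_intervals
      (hc.intervalIntegrable 0 Real.pi) (hc.intervalIntegrable Real.pi (2 * Real.pi))]
  congr 1
  have := intervalIntegral.integral_comp_add_right (a := 0) (b := Real.pi)
    (fun s => deriv X (r * Real.sin s)) Real.pi
  rw [zero_add, ← two_mul] at this
  rw [← this]
  simp [Real.sin_add_pi]

/-! ### Isochronicity and evenness of the second derivative of `X` -/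

lemma exists_orbitPeriod_eq_of_isochronous (hiso : IsIsochronousCenter g) :
    ∃ T, ∀ᶠ r in 𝓝[>] (0 : ℝ), orbitPeriod X r = T := by
  obtain ⟨T, hT⟩ := hiso
  refine ⟨T, ?_⟩
  have ht : Tendsto (fun r : ℝ => ((0 : ℝ), r)) (𝓝[>] 0) (𝓝[≠] 0) := by
    refine tendsto_nhdsWithin_iff.2 ⟨?_, ?_⟩
    · have : Continuous fun r : ℝ => ((0 : ℝ), r) := by fun_prop
      exact (this.tendsto 0).mono_left nhdsWithin_le_nhds
    · filter_upwards [self_mem_nhdsWithin] with r hr h0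
      simp only [mem_singleton_iff, Prod.mk_eq_zero, true_and] at h0
      exact (ne_of_gt hr) h0
  filter_upwards [ht.eventually hT, Ioo_mem_nhdsGT h.pos] with r ⟨γ, hγ, hγ0, hper⟩ hr
  obtain ⟨γ', hγ', hγ0', hper', han⟩ := h.exists_trajectory hr 0
  -- The given periodic orbit through `(0, r)` is the constructed one, so the minimal periods agree.
  have heq : γ' = γ := hγ'.eq_of_apply_zero_eq hγ (by
    rw [hγ0, hγ0']
    simp [h.zero]) han
  rw [heq] at hper'
  exact hper'.unique hper

lemma hasDerivAt_deriv_add_deriv_neg {u : ℝ} (hu : u ∈ Ioo (-R) R) :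
    HasDerivAt (fun u => deriv X u + deriv X (-u))
      (deriv (deriv X) u - deriv (deriv X) (-u)) u := by
  have hu' : -u ∈ Ioo (-R) R := ⟨by linarith [hu.2], by linarith [hu.1]⟩
  have h1 := (h.analytic u hu).deriv.differentiableAt.hasDerivAt
  have h2 := (h.analytic _ hu').deriv.differentiableAt.hasDerivAt.comp u (hasDerivAt_neg u)
  refine (h1.add h2).congr_deriv ?_
  ring

/-- With `E(u) = X'(u) + X'(-u) - T/π`, all integrals of `E(r sin s)` over `[0, π]` vanish for small
`r`. If `E` were not zero near `0`, its zeros would be isolated, so `E` would keep one sign on some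
`(0, r]` and the integral could not vanish. -/
lemma even_of_isochronous (hiso : IsIsochronousCenter g) :
    ∀ᶠ u in 𝓝 0, deriv (deriv X) (-u) = deriv (deriv X) u := by
  obtain ⟨T, hT⟩ := h.exists_orbitPeriod_eq_of_isochronous hiso
  set E : ℝ → ℝ := fun u => deriv X u + deriv X (-u) - T / Real.pi with hE
  have hEan : ∀ u ∈ Ioo (-R) R, AnalyticAt ℝ E u := fun u hu =>
    ((h.analytic u hu).deriv.fun_add (AnalyticAt.comp (g := deriv X) (f := fun u => -u)
      (h.analytic (-u) ⟨by linarith [hu.2], by linarith [hu.1]⟩).deriv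
        analyticAt_id.fun_neg)).fun_sub analyticAt_const
  have hint : ∀ᶠ r in 𝓝[>] (0 : ℝ), r < R ∧ ∫ s in (0 : ℝ)..Real.pi, E (r * Real.sin s) = 0 := by
    filter_upwards [hT, Ioo_mem_nhdsGT h.pos] with r h1 hr
    refine ⟨hr.2, ?_⟩
    have hc := h.continuous_deriv_mul_sin hr
    have hc' := hc.fun_add (h.continuous_deriv_neg_mul_sin hr)
    rw [h.orbitPeriod_eq hr] at h1
    simp only [hE]
    rw [intervalIntegral.integral_sub (hc'.intervalIntegrable _ _) (by simp), h1]
    simp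
  have hE0 : ∀ᶠ u in 𝓝 0, E u = 0 := by
    refine (hEan 0 h.zero_mem).eventually_eq_zero_or_eventually_ne_zero.resolve_right fun hne => ?_
    obtain ⟨η, hη, hηE⟩ := mem_nhdsGT_iff_exists_Ioo_subset.1 (nhdsGT_le_nhdsNE (0 : ℝ) hne)
    obtain ⟨r, ⟨hrR, hr0⟩, hr⟩ := (hint.and (Ioo_mem_nhdsGT hη)).exists
    have hsub : ∀ u ∈ Ioc 0 r, u ∈ Ioo (-R) R := fun u hu =>
      ⟨by linarith [hu.1, h.pos], by linarith [hu.2]⟩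
    have hEc : ContinuousOn E (Ioc 0 r) := fun u hu =>
      (hEan u (hsub u hu)).continuousAt.continuousWithinAt
    have hEne : ∀ u ∈ Ioc 0 r, E u ≠ 0 := fun u hu => hηE ⟨hu.1, hu.2.trans_lt hr.2⟩
    have hmem : ∀ s ∈ Ioo 0 Real.pi, r * Real.sin s ∈ Ioc 0 r := fun s hs =>
      ⟨mul_pos hr.1 (Real.sin_pos_of_mem_Ioo hs),
        mul_le_of_le_one_right hr.1.le (Real.sin_le_one s)⟩
    have hcont : Continuous fun s => E (r * Real.sin s) := by
      refine continuous_iff_continuousAt.2 fun s => ?_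
      exact ContinuousAt.comp (g := E) (f := fun s => r * Real.sin s)
        (hEan _ (mul_sin_mem ⟨hr.1, hrR⟩ s)).continuousAt (by fun_prop)
    have hsign : (∀ u ∈ Ioc 0 r, 0 < E u) ∨ ∀ u ∈ Ioc 0 r, E u < 0 := by
      by_contra! hcon
      obtain ⟨⟨u, hu, hu0⟩, v, hv, hv0⟩ := hcon
      obtain ⟨z, hz, hz0⟩ := isPreconnected_Ioc.intermediate_value hu hv hEc ⟨hu0, hv0⟩
      exact hEne z hz hz0
    rcases hsign with hs | hs
    · exact (intervalIntegral.intervalIntegral_pos_of_pos_on (hcont.intervalIntegrable _ _)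
        (fun s hs' => hs _ (hmem s hs')) Real.pi_pos).ne' hr0
    · have := intervalIntegral.intervalIntegral_pos_of_pos_on
        (hcont.fun_neg.intervalIntegrable 0 Real.pi)
        (fun s hs' => neg_pos.2 (hs _ (hmem s hs'))) Real.pi_pos
      rw [intervalIntegral.integral_neg, hr0] at this
      simp at this
  filter_upwards [hE0.eventually_nhds, isOpen_Ioo.mem_nhds h.zero_mem] with u hu huR
  have h1 := (h.hasDerivAt_deriv_add_deriv_neg huR).sub_const (T / Real.pi)
  have h2 := h1.unique ((hasDerivAt_const u (0 : ℝ)).congr_of_eventuallyEq hu)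
  linarith

/-- Evenness of `X''` makes `X'(u) + X'(-u)` constant, equal to `2 X'(0) = 2`. -/
lemma orbitPeriod_eq_of_even (heven : ∀ᶠ u in 𝓝 0, deriv (deriv X) (-u) = deriv (deriv X) u) :
    ∃ η > 0, ∀ r ∈ Ioo 0 η, r < R ∧ orbitPeriod X r = 2 * Real.pi := by
  obtain ⟨η, hη, hb⟩ := Metric.eventually_nhds_iff_ball.1
    (heven.and (isOpen_Ioo.mem_nhds h.zero_mem))
  have hd : ∀ u ∈ Metric.ball (0 : ℝ) η,
      HasDerivAt (fun u => deriv X u + deriv X (-u)) 0 u := fun u hu => by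
    refine (h.hasDerivAt_deriv_add_deriv_neg (hb u hu).2).congr_deriv ?_
    rw [(hb u hu).1, sub_self]
  have hconst : ∀ u ∈ Metric.ball (0 : ℝ) η, deriv X u + deriv X (-u) = 2 := fun u hu => by
    have h1 := (convex_ball (0 : ℝ) η).is_const_of_fderivWithin_eq_zero (𝕜 := ℝ)
      (fun y hy => (hd y hy).differentiableAt.differentiableWithinAt)
      (fun y hy => by
        rw [fderivWithin_of_isOpen Metric.isOpen_ball hy, (hd y hy).hasFDerivAt.fderiv]
        simp) hu (Metric.mem_ball_self hη)
    simp only [neg_zero, h.deriv_zero] at h1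
    linarith
  refine ⟨η, hη, fun r hr => ?_⟩
  have hrR : r < R := (hb r (by simpa [abs_of_pos hr.1] using hr.2)).2.2
  refine ⟨hrR, ?_⟩
  have h1 : ∀ s, deriv X (r * Real.sin s) + deriv X (-(r * Real.sin s)) = 2 := fun s => by
    refine hconst _ ?_
    rw [mem_ball_zero_iff, Real.norm_eq_abs, abs_mul, abs_of_pos hr.1]
    exact (mul_le_of_le_one_right hr.1.le (Real.abs_sin_le_one s)).trans_lt hr.2
  rw [h.orbitPeriod_eq ⟨hr.1, hrR⟩]
  simp only [h1]
  simp
  ring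

lemma isochronous_of_even (heven : ∀ᶠ u in 𝓝 0, deriv (deriv X) (-u) = deriv (deriv X) u) :
    IsIsochronousCenter g := by
  obtain ⟨η, hη, hP⟩ := h.orbitPeriod_eq_of_even heven
  refine ⟨2 * Real.pi, ?_⟩
  have hstrict := (h.analytic 0 h.zero_mem).hasStrictDerivAt
  -- Since `X'(0) ≠ 0`, `X` is open at `0`: every point near the origin is `(X(u), y)` with `u`
  -- small.
  have hmap := hstrict.map_nhds_eq (by rw [h.deriv_zero]; norm_num)
  have hη2 : 0 < η / 2 := by positivity
  have himg : X '' Ioo (-(η / 2)) (η / 2) ∈ 𝓝 (0 : ℝ) := by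
    have : X '' Ioo (-(η / 2)) (η / 2) ∈ map X (𝓝 0) :=
      image_mem_map (Ioo_mem_nhds (neg_lt_zero.2 hη2) hη2)
    rwa [hmap, h.zero] at this
  have h1 : ∀ᶠ p in 𝓝[≠] (0 : ℝ × ℝ), p.1 ∈ X '' Ioo (-(η / 2)) (η / 2) :=
    (continuous_fst.tendsto (0 : ℝ × ℝ)).mono_left nhdsWithin_le_nhds himg
  have h2 : ∀ᶠ p in 𝓝[≠] (0 : ℝ × ℝ), p.2 ∈ Ioo (-(η / 2)) (η / 2) :=
    (continuous_snd.tendsto (0 : ℝ × ℝ)).mono_left nhdsWithin_le_nhds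
      (Ioo_mem_nhds (neg_lt_zero.2 hη2) hη2)
  filter_upwards [h1, h2, self_mem_nhdsWithin] with p ⟨u, hu, hup⟩ hp hp0
  -- The polar form of `y + i u` supplies the radius `r` and the starting angle; `η / 2` on each
  -- coordinate ensures `r < η`.
  set z : ℂ := ⟨p.2, u⟩ with hz
  have hz0 : z ≠ 0 := fun hz0 => hp0 (by
    have h3 : p.2 = 0 := congrArg Complex.re hz0
    have h4 : u = 0 := congrArg Complex.im hz0
    rw [h4, h.zero] at hup
    exact Prod.ext hup.symm h3)
  have hzη : ‖z‖ < η := by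
    refine (Complex.norm_le_abs_re_add_abs_im z).trans_lt ?_
    have h3 := abs_lt.2 ⟨hp.1, hp.2⟩
    have h4 := abs_lt.2 ⟨hu.1, hu.2⟩
    simp only [hz]
    linarith
  obtain ⟨hR, hper⟩ := hP ‖z‖ ⟨norm_pos_iff.2 hz0, hzη⟩
  obtain ⟨γ, hγ, hγ0, hγP, -⟩ := h.exists_trajectory ⟨norm_pos_iff.2 hz0, hR⟩ z.arg
  refine ⟨γ, hγ, ?_, hper ▸ hγP⟩
  rw [hγ0, Complex.norm_mul_sin_arg, Complex.norm_mul_cos_arg]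
  exact Prod.ext hup rfl

end IsEnergyParam

/-! ### The sign of each branch and the main theorem -/

lemma eqOn_explicitSolution_of_tendsto {f x : ℝ → ℝ} {δ ε : ℝ} (hδ : 0 < δ)
    (hf : AnalyticOnNhd ℝ f (Ico 0 δ)) (hx : IsAnalyticSolution f x δ) (hi : InitialConditions x)
    (ht : Tendsto (fun s => x s / √(2 * s)) (𝓝[>] 0) (𝓝 ε)) :
    EqOn x (explicitSolution ε f) (Ico 0 δ) := by
  -- The limit of `x / √(2s)` decides between the two signs.
  have key : ∀ ε', EqOn x (explicitSolution ε' f) (Ico 0 δ) → ε' = ε := fun ε' h => by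
    refine tendsto_nhds_unique ((tendsto_explicitSolution_div ε' hδ hf).congr' ?_) ht
    filter_upwards [Ioo_mem_nhdsGT hδ] with s hs
    rw [h ⟨hs.1.le, hs.2⟩]
  rcases (isAnalyticSolution_and_initialConditions_iff hδ hf x).1 ⟨hx, hi⟩ with h | h
  · exact key 1 h ▸ h
  · exact key (-1) h ▸ h

end ConservativeCenter

open ConservativeCenter

theorem mainTheorem9 (g : ℝ → ℝ) (a b c : ℝ)
    (hg : AnalyticOnNhd ℝ g (Icc a b))
    (hH : ConservativeCenter.HypothesisH g a b c)
    (hg0 : g 0 = 0) (hg1 : deriv g 0 = 1) :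
    -- isochronicity is equivalent to the linear equation for `x = x(G)`
    (∀ δ : ℝ, 0 < δ → δ ≤ c →
      List.TFAE [
        ConservativeCenter.IsIsochronousCenter g,
        ∃ f : ℝ → ℝ, AnalyticOnNhd ℝ f (Ico 0 δ) ∧
          ConservativeCenter.IsAnalyticSolution f (ConservativeCenter.rightBranch g b) δ,
        ∃ f : ℝ → ℝ, AnalyticOnNhd ℝ f (Ico 0 δ) ∧
          ConservativeCenter.IsAnalyticSolution f (ConservativeCenter.leftBranch g a) δ,
        ∃ f : ℝ → ℝ, AnalyticOnNhd ℝ f (Ico 0 δ) ∧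
          ConservativeCenter.IsAnalyticSolution f (ConservativeCenter.rightBranch g b) δ ∧
          ConservativeCenter.IsAnalyticSolution f (ConservativeCenter.leftBranch g a) δ]) ∧
    -- the initial conditions
    ConservativeCenter.InitialConditions (ConservativeCenter.rightBranch g b) ∧
    ConservativeCenter.InitialConditions (ConservativeCenter.leftBranch g a) ∧
    -- for every analytic `f`: the solutions of the equation with these initial conditions
    (∀ (δ : ℝ) (f : ℝ → ℝ), 0 < δ → AnalyticOnNhd ℝ f (Ico 0 δ) →
      (∀ s ∈ Ico 0 δ, IntervalIntegrable (ConservativeCenter.integrand f) MeasureTheory.volume 0 s) ∧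
      ∀ x : ℝ → ℝ,
        (ConservativeCenter.IsAnalyticSolution f x δ ∧ ConservativeCenter.InitialConditions x) ↔
          (EqOn x (ConservativeCenter.explicitSolution 1 f) (Ico 0 δ) ∨
            EqOn x (ConservativeCenter.explicitSolution (-1) f) (Ico 0 δ))) ∧
    -- the solution given by the inverse of the potential
    (∀ (δ : ℝ) (f : ℝ → ℝ), 0 < δ → δ ≤ c → AnalyticOnNhd ℝ f (Ico 0 δ) →
      (ConservativeCenter.IsAnalyticSolution f (ConservativeCenter.rightBranch g b) δ →
        EqOn (ConservativeCenter.rightBranch g b)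
          (ConservativeCenter.explicitSolution 1 f) (Ico 0 δ)) ∧
      (ConservativeCenter.IsAnalyticSolution f (ConservativeCenter.leftBranch g a) δ →
        EqOn (ConservativeCenter.leftBranch g a)
          (ConservativeCenter.explicitSolution (-1) f) (Ico 0 δ))) := by
  have hX := hH.isEnergyParam hg hg0 hg1
  set X := energyParam g a b with hXdef
  have hc := hH.c_pos
  have hsq1 : (1 : ℝ) ^ 2 = 1 := by norm_num
  have hsq2 : (-1 : ℝ) ^ 2 = 1 := by norm_num
  have hr : EqOn (rightBranch g b) (fun s => X (1 * √(2 * s))) (Ici 0) := fun s hs =>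
    HypothesisH.rightBranch_eq hs
  have hl : EqOn (leftBranch g a) (fun s => X (-1 * √(2 * s))) (Ici 0) := fun s hs =>
    hH.leftBranch_eq hg hs
  have hIoo : ∀ δ : ℝ, Ioo 0 δ ⊆ Ici 0 := fun δ s hs => hs.1.le
  have hIco : ∀ δ : ℝ, Ico 0 δ ⊆ Ici 0 := fun δ s hs => hs.1
  have hle : ∀ δ : ℝ, δ ≤ c → √(2 * δ) ≤ √(2 * c) := fun δ h => Real.sqrt_le_sqrt (by linarith)
  have hir : InitialConditions (rightBranch g b) :=
    (hX.initialConditions_comp_sqrt hsq1).congr hc (hr.mono (hIco c))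
  have hil : InitialConditions (leftBranch g a) :=
    (hX.initialConditions_comp_sqrt hsq2).congr hc (hl.mono (hIco c))
  refine ⟨fun δ hδ hδc => ?_, hir, hil, fun δ f hδ hf =>
    ⟨fun s hs => intervalIntegrable_integrand hf hs,
      isAnalyticSolution_and_initialConditions_iff hδ hf⟩,
    fun δ f hδ hδc hf => ⟨fun hx => ?_, fun hx => ?_⟩⟩
  · tfae_have 1 → 4 := fun hiso => by
      obtain ⟨f, hf, h1, h2⟩ :=
        hX.exists_isAnalyticSolution_of_even (hX.even_of_isochronous hiso) (hle δ hδc)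
      exact ⟨f, hf, h1.congr (hr.mono (hIoo δ)), h2.congr (hl.mono (hIoo δ))⟩
    tfae_have 4 → 2 := fun ⟨f, hf, h1, _⟩ => ⟨f, hf, h1⟩
    tfae_have 4 → 3 := fun ⟨f, hf, _, h2⟩ => ⟨f, hf, h2⟩
    tfae_have 2 → 1 := fun ⟨f, hf, h1⟩ =>
      hX.isochronous_of_even (hX.even_of_isAnalyticSolution hsq1 hδ (hle δ hδc)
        (hf 0 ⟨le_rfl, hδ⟩) (h1.congr (hr.mono (hIoo δ)).symm))
    tfae_have 3 → 1 := fun ⟨f, hf, h1⟩ =>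
      hX.isochronous_of_even (hX.even_of_isAnalyticSolution hsq2 hδ (hle δ hδc)
        (hf 0 ⟨le_rfl, hδ⟩) (h1.congr (hl.mono (hIoo δ)).symm))
    tfae_finish
  · refine eqOn_explicitSolution_of_tendsto hδ hf hx hir
      ((hX.tendsto_comp_sqrt_div hsq1).congr' ?_)
    filter_upwards [self_mem_nhdsWithin] with s hs
    rw [hr (mem_Ici.2 (le_of_lt hs))]
  · refine eqOn_explicitSolution_of_tendsto hδ hf hx hil
      ((hX.tendsto_comp_sqrt_div hsq2).congr' ?_)
    filter_upwards [self_mem_nhdsWithin] with s hs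
    rw [hl (mem_Ici.2 (le_of_lt hs))]
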